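/- Let $(X,Y)$ be a pair of discrete random variables with joint law $P_{XY}$ on alphabets $\mathcal X\times\mathcal Y$, where $\mathcal X$ is finite and $\mathcal Y$ is finite or countably infinite. All logarithms are to base $2$, and entropies and mutual informations are measured in bits, with values in $[0,\infty]$ (and $0\cdot\infty=0$). For $\epsilon\ge 0$ let $$h_\epsilon(P_{XY})=\sup\{I(Y;U): P_{U|X,Y}\text{ with } I(U;X)\le\epsilon\},\qquad g_0(P_{XY})=\sup\{I(Y;U): P_{U|X,Y}\text{ with } I(U;X)=0,\ X-Y-U\},$$ where $U$ ranges over random variables with a finite or countable alphabet generated from $(X,Y)$ by a kernel $P_{U|X,Y}$, and $X-Y-U$ means that $X$ and $U$ are conditionally independent given $Y$. A representation $X=(X_1,X_2)$ is an injective encoding of the symbols of $\mathcal X$ by pairs from finite alphabets $\mathcal X_1\times\mathcal X_2$ with $|\mathcal X_1|,|\mathcal X_2|\ge 2$; let $\mathcal S_X$ be the set of all representations with $H(X_2)>0$, and for these put $\alpha_2=\epsilon/H(X_2)$. Let $\mathcal S_X^{\epsilon}\subseteq\mathcal S_X$ be the set of those with $\alpha_2\le 1$, that is $H(X_2)\ge\epsilon$.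 **Theorem.** Suppose that $0\le\epsilon<I(X;Y)$, and put $\alpha=\epsilon/H(X)$. Then $$\max\{L_1^\epsilon,L_2^\epsilon,L_3^\epsilon,L_4^\epsilon,L_5^\epsilon\}\le h_\epsilon(P_{XY})\le U_1^\epsilon,$$ where $$\begin{aligned} U_1^\epsilon&=H(Y|X)+\epsilon,\\ L_1^\epsilon&=H(Y|X)-H(X|Y)+\epsilon=H(Y)-H(X)+\epsilon,\\ L_2^\epsilon&=H(Y|X)-\alpha H(X|Y)+\epsilon-(1-\alpha)\bigl(\log(I(X;Y)+1)+4\bigr),\\ L_3^\epsilon&=\epsilon\,\frac{H(Y)}{I(X;Y)}+g_0(P_{XY})\Bigl(1-\frac{\epsilon}{I(X;Y)}\Bigr),\\ L_4^\epsilon&=H(Y|X)+\epsilon-\bigl(\log(I(X;Y)+1)+4\bigr)-\min_{(X_1,X_2)\in\mathcal S_X}\alpha_2H(X_2|Y),\\ L_5^\epsilon&=H(Y|X)+\epsilon-\min_{(X_1,X_2)\in\mathcal S_X^{\epsilon}}\Bigl\{(1-\alpha_2)\bigl(\log(I(X;Y)+1)+4\bigr)+\alpha_2H(X|Y)\Bigr\}.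 \end{aligned}$$ The lower bound is tight, i.e. $\max\{L_1^\epsilon,\dots,L_5^\epsilon\}=h_\epsilon(P_{XY})$, if $H(X|Y)=0$, i.e. if $X$ is (almost surely) a deterministic function of $Y$. Conversely, if $H(Y)<\infty$ and $L_1^\epsilon$ is tight, i.e. $L_1^\epsilon=h_\epsilon(P_{XY})$, then $H(X|Y)=0$. -/

import Mathlib

open scoped ENNReal

noncomputable section

namespace PrivacyFunnel

/-- Shannon entropy (in bits) of a discrete distribution, with values in `[0, ∞]`:
`H(p) = - ∑ p(a) log₂ p(a)`. Every summand is nonnegative. -/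
def entropy {α : Type*} (p : PMF α) : ℝ≥0∞ :=
  ∑' a, ENNReal.ofReal (-((p a).toReal * Real.logb 2 (p a).toReal))

/-- Conditional entropy `H(B | A)` (in bits) of the second coordinate given the first one, for
a pair `(A, B)` with joint distribution `J`: `- ∑ J(a, b) log₂ (J(a, b) / J_A(a))`.
Every summand is nonnegative, and the summands with `J(a, b) = 0` vanish. -/
def condEntropy {α β : Type*} (J : PMF (α × β)) : ℝ≥0∞ :=
  ∑' z : α × β, ENNReal.ofReal
    (-((J z).toReal * Real.logb 2 ((J z).toReal / (J.map Prod.fst z.1).toReal)))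

/-- Product of two discrete distributions (the law of an independent pair). -/
def indepLaw {α β : Type*} (p : PMF α) (q : PMF β) : PMF (α × β) :=
  p.bind fun a => q.map fun b => (a, b)

/-- Kullback-Leibler divergence in bits of two discrete distributions
(all subsets of the alphabet are measurable). -/
def klBits {α : Type*} (p q : PMF α) : ℝ≥0∞ :=
  @InformationTheory.klDiv α ⊤ (@PMF.toMeasure α ⊤ p) (@PMF.toMeasure α ⊤ q)
    / ENNReal.ofReal (Real.log 2)

/-- Mutual information `I(A; B)` (in bits) of a pair `(A, B)` with joint distribution `J`:
the divergence of `J` from the product of its marginals. -/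
def mutualInfo {α β : Type*} (J : PMF (α × β)) : ℝ≥0∞ :=
  klBits J (indepLaw (J.map Prod.fst) (J.map Prod.snd))

section Mechanism

variable {𝒳 𝒴 : Type*}

/-- Joint law of `((X, Y), U)` when `(X, Y)` has law `P` and `U` is generated from `(X, Y)` by
the kernel `κ = P_{U | X, Y}`. The alphabet of `U` is discrete (finite or countably infinite);
without loss of generality it is embedded into `ℕ`. -/
def jointLaw (P : PMF (𝒳 × 𝒴)) (κ : 𝒳 × 𝒴 → PMF ℕ) : PMF ((𝒳 × 𝒴) × ℕ) :=
  P.bind fun z => (κ z).map fun u => (z, u)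

/-- Joint law of `(X, U)`. -/
def lawXU (P : PMF (𝒳 × 𝒴)) (κ : 𝒳 × 𝒴 → PMF ℕ) : PMF (𝒳 × ℕ) :=
  (jointLaw P κ).map fun w => (w.1.1, w.2)

/-- Joint law of `(Y, U)`. -/
def lawYU (P : PMF (𝒳 × 𝒴)) (κ : 𝒳 × 𝒴 → PMF ℕ) : PMF (𝒴 × ℕ) :=
  (jointLaw P κ).map fun w => (w.1.2, w.2)

/-- The Markov chain `X - Y - U`: `X` and `U` are conditionally independent given `Y`, that is
`P(x, y, u) P(y) = P(x, y) P(y, u)`. -/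
def IsMarkov (P : PMF (𝒳 × 𝒴)) (κ : 𝒳 × 𝒴 → PMF ℕ) : Prop :=
  ∀ x y u, jointLaw P κ ((x, y), u) * P.map Prod.snd y = P (x, y) * lawYU P κ (y, u)

/-- The privacy-utility function
`h_ε(P_{XY}) = sup { I(Y; U) : P_{U | X, Y} with I(U; X) ≤ ε }`. -/
def hFun (ε : ℝ) (P : PMF (𝒳 × 𝒴)) : ℝ≥0∞ :=
  ⨆ (κ : 𝒳 × 𝒴 → PMF ℕ) (_ : mutualInfo (lawXU P κ) ≤ ENNReal.ofReal ε),
    mutualInfo (lawYU P κ)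

/-- The perfect privacy function
`g_0(P_{XY}) = sup { I(Y; U) : P_{U | X, Y} with I(U; X) = 0 and X - Y - U }`. -/
def gZero (P : PMF (𝒳 × 𝒴)) : ℝ≥0∞ :=
  ⨆ (κ : 𝒳 × 𝒴 → PMF ℕ) (_ : mutualInfo (lawXU P κ) = 0 ∧ IsMarkov P κ),
    mutualInfo (lawYU P κ)

end Mechanism

/-- A representation `X = (X₁, X₂)` of a random variable with alphabet `𝒳`: an injective encoding
of the symbols of `𝒳` by pairs from two finite alphabets with at least two symbols each. -/
structure Representation (𝒳 : Type*) where
  /-- size of the alphabet of `X₁` -/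
  m : ℕ
  /-- size of the alphabet of `X₂` -/
  n : ℕ
  two_le_m : 2 ≤ m
  two_le_n : 2 ≤ n
  /-- the encoding of a symbol by a pair -/
  enc : 𝒳 → Fin m × Fin n
  enc_injective : Function.Injective enc

section Bounds

variable {𝒳 𝒴 : Type*}

/-- `H(X)`. -/
def HX (P : PMF (𝒳 × 𝒴)) : ℝ≥0∞ := entropy (P.map Prod.fst)

/-- `H(Y)`. -/
def HY (P : PMF (𝒳 × 𝒴)) : ℝ≥0∞ := entropy (P.map Prod.snd)

/-- `H(Y | X)`. -/
def HYgivenX (P : PMF (𝒳 × 𝒴)) : ℝ≥0∞ := condEntropy P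

/-- `H(X | Y)`. -/
def HXgivenY (P : PMF (𝒳 × 𝒴)) : ℝ≥0∞ := condEntropy (P.map Prod.swap)

/-- `H(X₂)` for a representation `X = (X₁, X₂)`. -/
def HX2 (P : PMF (𝒳 × 𝒴)) (r : Representation 𝒳) : ℝ≥0∞ :=
  entropy (P.map fun z => (r.enc z.1).2)

/-- `H(X₂ | Y)` for a representation `X = (X₁, X₂)`. -/
def HX2givenY (P : PMF (𝒳 × 𝒴)) (r : Representation 𝒳) : ℝ≥0∞ :=
  condEntropy (P.map fun z => (z.2, (r.enc z.1).2))

/-- `α = ε / H(X)`; the entropy is finite when the alphabet of `X` is. -/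
def alpha (ε : ℝ) (P : PMF (𝒳 × 𝒴)) : ℝ := ε / (HX P).toReal

/-- `α₂ = ε / H(X₂)` for a representation `X = (X₁, X₂)`. -/
def alpha2 (ε : ℝ) (P : PMF (𝒳 × 𝒴)) (r : Representation 𝒳) : ℝ := ε / (HX2 P r).toReal

/-- The constant `log₂ (I(X; Y) + 1) + 4`; the mutual information is finite when the alphabet of
`X` is. -/
def sfrlConst (P : PMF (𝒳 × 𝒴)) : ℝ := Real.logb 2 ((mutualInfo P).toReal + 1) + 4

/-- `U₁ = H(Y | X) + ε`. -/
def U1 (ε : ℝ) (P : PMF (𝒳 × 𝒴)) : EReal := (HYgivenX P : EReal) + (ε : EReal)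

/-- `L₁ = H(Y | X) - H(X | Y) + ε`. -/
def L1 (ε : ℝ) (P : PMF (𝒳 × 𝒴)) : EReal :=
  (HYgivenX P : EReal) - (HXgivenY P : EReal) + (ε : EReal)

/-- `L₂ = H(Y | X) - α H(X | Y) + ε - (1 - α) (log₂ (I(X; Y) + 1) + 4)`. -/
def L2 (ε : ℝ) (P : PMF (𝒳 × 𝒴)) : EReal :=
  (HYgivenX P : EReal) - ((alpha ε P * (HXgivenY P).toReal : ℝ) : EReal) + (ε : EReal)
    - (((1 - alpha ε P) * sfrlConst P : ℝ) : EReal)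

/-- `L₃ = ε H(Y) / I(X; Y) + g_0(P_{XY}) (1 - ε / I(X; Y))`. -/
def L3 (ε : ℝ) (P : PMF (𝒳 × 𝒴)) : EReal :=
  ((ε / (mutualInfo P).toReal : ℝ) : EReal) * (HY P : EReal)
    + (gZero P : EReal) * ((1 - ε / (mutualInfo P).toReal : ℝ) : EReal)

/-- `L₄ = H(Y | X) + ε - (log₂ (I(X; Y) + 1) + 4) - min { α₂ H(X₂ | Y) }`, over the
representations `X = (X₁, X₂)` for which `α₂` is defined, that is `H(X₂) > 0`. -/
def L4 (ε : ℝ) (P : PMF (𝒳 × 𝒴)) : EReal :=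
  (HYgivenX P : EReal) + (ε : EReal) - (sfrlConst P : EReal)
    - ⨅ (r : Representation 𝒳) (_ : 0 < HX2 P r),
        ((alpha2 ε P r * (HX2givenY P r).toReal : ℝ) : EReal)

/-- `L₅ = H(Y | X) + ε - min { (1 - α₂) (log₂ (I(X; Y) + 1) + 4) + α₂ H(X | Y) }`, over the
representations `X = (X₁, X₂)` for which `α₂` is defined and is a probability, that is
`H(X₂) > 0` and `ε ≤ H(X₂)`. -/
def L5 (ε : ℝ) (P : PMF (𝒳 × 𝒴)) : EReal :=
  (HYgivenX P : EReal) + (ε : EReal)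
    - ⨅ (r : Representation 𝒳) (_ : 0 < HX2 P r ∧ ENNReal.ofReal ε ≤ HX2 P r),
        (((1 - alpha2 ε P r) * sfrlConst P + alpha2 ε P r * (HXgivenY P).toReal : ℝ) : EReal)

end Bounds

end PrivacyFunnel

end

/-! Lower bounds: run an exponential race. Give each symbol `y` an independent clock `ω y` of mean
one and let the input `x` select the `y` that minimizes `ω y / P(y|x)`. The selected symbol has law
`P(·|x)`, so the random map `U : 𝒳 → 𝒴` of all selections can be coupled with `(X, Y)` so that `U`
is independent of `X` and `Y = U(X)`. Hence `I(Y;U) = H(Y) - H(Y|U)`, where `H(Y|U)` averages the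
entropies of `u(X)`. Two estimates hold: `H(Y|U) ≤ H(X)`, because `u(X)` is a function of `X`
(`raceEntropy_le_HX`), and `H(Y|U) ≤ I(X;Y) + log(I(X;Y)+1) + 4`, because arrival times describe the
selected symbol cheaply (`raceEntropy_le`).

To use the leakage budget, disclose `Y` itself with probability `ε / I(X;Y)` and otherwise `U`,
together with which of the two was used. Both mutual informations are affine under this mixture, so
the leakage is exactly `ε` and the utility is at least `H(Y|X) + ε - d` whenever `H(Y|U) ≤ I(X;Y) +
d` (`HYgivenX_add_le_hFun_add`). The value `d = min(log(I(X;Y)+1)+4, H(X|Y))` is at most each of the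
penalties in `L1`, `L2`, `L4`, `L5`. `L3` comes from the same mixture with a competitor of `gZero`
in place of the race.

Upper bound: `H(X|U) ≤ H(Y|U) + H(X|Y)` (`condEntropy_triangle`) rearranges to `I(Y;U) ≤ H(Y|X) +
I(X;U)`.

Tightness: if `H(X|Y) = 0` then `L1 = U1`. If `H(X|Y) ≠ 0`, two inputs share a possible symbol, and
the race sends both to it with positive probability. Then `U` merges inputs, `H(Y|U) < H(X)`
strictly, and the race mixture beats `L1`. -/

open scoped ENNReal

namespace PrivacyFunnel

/-! ### Sums and marginals of discrete laws -/

section Sums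

variable {α β : Type*}

theorem tsum_map_mul (p : PMF α) (f : α → β) (g : β → ℝ≥0∞) :
    ∑' b, p.map f b * g b = ∑' a, p a * g (f a) := by
  classical
  simp_rw [PMF.map_apply, ← ENNReal.tsum_mul_right]
  rw [ENNReal.tsum_comm]
  refine tsum_congr fun a => ?_
  rw [tsum_eq_single (f a)]
  · simp
  · intro b hb
    simp [hb]

theorem map_fst_apply (J : PMF (α × β)) (a : α) : J.map Prod.fst a = ∑' b, J (a, b) := by
  classical
  rw [PMF.map_apply, ENNReal.tsum_prod', tsum_eq_single a]
  · simp
  · intro a' h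
    simp [Ne.symm h]

theorem map_snd_apply (J : PMF (α × β)) (b : β) : J.map Prod.snd b = ∑' a, J (a, b) := by
  classical
  rw [PMF.map_apply, ENNReal.tsum_prod']
  refine tsum_congr fun a => ?_
  rw [tsum_eq_single b]
  · simp
  · intro b' h
    simp [Ne.symm h]

theorem apply_le_map (p : PMF α) (f : α → β) (a : α) : p a ≤ p.map f (f a) := by
  classical
  rw [PMF.map_apply]
  refine le_trans ?_ (ENNReal.le_tsum a)
  simp

theorem map_apply_injective (p : PMF α) {f : α → β} (hf : Function.Injective f) (a : α) :
    p.map f (f a) = p a := by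
  classical
  rw [PMF.map_apply, tsum_eq_single a]
  · simp
  · intro b hb
    simp [hf.ne hb.symm]

theorem map_apply_eq_zero (p : PMF α) (f : α → β) {b : β} (hb : b ∉ Set.range f) :
    p.map f b = 0 := by
  classical
  rw [PMF.map_apply, ENNReal.tsum_eq_zero]
  intro a
  rw [if_neg]
  rintro rfl
  exact hb ⟨a, rfl⟩

theorem indepLaw_apply (p : PMF α) (q : PMF β) (z : α × β) : indepLaw p q z = p z.1 * q z.2 := by
  classical
  obtain ⟨a, b⟩ := z
  rw [indepLaw, PMF.bind_apply, tsum_eq_single a]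
  · rw [map_apply_injective q (f := fun b => (a, b)) (fun x y h => by simpa using h)]
  · intro a' h
    rw [map_apply_eq_zero, mul_zero]
    rintro ⟨b', hb'⟩
    exact h (by simpa using (Prod.ext_iff.1 hb').1)

theorem map_fst_swap (J : PMF (α × β)) : (J.map Prod.swap).map Prod.fst = J.map Prod.snd := by
  rw [PMF.map_comp]; rfl

theorem map_snd_swap (J : PMF (α × β)) : (J.map Prod.swap).map Prod.snd = J.map Prod.fst := by
  rw [PMF.map_comp]; rfl

theorem tsum_indep_mul (p : PMF α) (q : PMF β) : ∑' z : α × β, p z.1 * q z.2 = 1 := by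
  simp_rw [← indepLaw_apply]
  exact PMF.tsum_coe _

end Sums

/-! ### Divergence as a sum of nonnegative terms -/

section Divergence

/-- Summand of the divergence (in nats) of finite measures, normalized so as to be nonnegative. -/
noncomputable def klTerm (a b : ℝ≥0∞) : ℝ≥0∞ :=
  ENNReal.ofReal (a.toReal * Real.log (a.toReal / b.toReal) + b.toReal - a.toReal)

theorem klTerm_arg_nonneg {a b : ℝ} (ha : 0 ≤ a) (hb : 0 ≤ b) (h : b = 0 → a = 0) :
    0 ≤ a * Real.log (a / b) + b - a := by
  rcases ha.eq_or_lt with rfl | ha'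
  · simpa using hb
  have hb' : 0 < b := lt_of_le_of_ne hb fun h' => ha'.ne' (h h'.symm)
  have := Real.one_sub_inv_le_log_of_pos (div_pos ha' hb')
  have h2 := mul_le_mul_of_nonneg_left this ha
  have : a * (1 - (a / b)⁻¹) = a - b := by field_simp
  linarith

theorem klTerm_zero_left (b : ℝ≥0∞) (hb : b ≠ ∞) : klTerm 0 b = b := by
  simp [klTerm, hb]

theorem klTerm_self (a : ℝ≥0∞) : klTerm a a = 0 := by
  by_cases h : a.toReal = 0 <;> simp [klTerm, h]

theorem klTerm_mul (c a b : ℝ≥0∞) (hc : c ≠ ∞) : klTerm (c * a) (c * b) = c * klTerm a b := by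
  rcases eq_or_ne c 0 with rfl | h0
  · simp [klTerm]
  have h0' : c.toReal ≠ 0 := (ENNReal.toReal_pos h0 hc).ne'
  unfold klTerm
  rw [ENNReal.toReal_mul, ENNReal.toReal_mul, mul_div_mul_left _ _ h0']
  conv_rhs => rw [← ENNReal.ofReal_toReal hc]
  rw [← ENNReal.ofReal_mul ENNReal.toReal_nonneg]
  congr 1
  ring

/-- The density of `p` with respect to `q` is `p a / q a`, and `q a` times `klFun` of this ratio is
`klTerm (p a) (q a)`. -/
theorem klDiv_toMeasure {α : Type*} [Countable α] (p q : PMF α) (h : ∀ a, q a = 0 → p a = 0) :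
    @InformationTheory.klDiv α ⊤ (@PMF.toMeasure α ⊤ p) (@PMF.toMeasure α ⊤ q)
      = ∑' a, klTerm (p a) (q a) := by
  let _ : MeasurableSpace α := ⊤
  have hd : p.toMeasure = q.toMeasure.withDensity fun a => p a / q a := by
    refine MeasureTheory.Measure.ext_of_singleton fun a => ?_
    rw [MeasureTheory.withDensity_apply _ (MeasurableSet.singleton a),
      MeasureTheory.lintegral_singleton, PMF.toMeasure_apply_singleton _ _ (MeasurableSet.singleton a),
      PMF.toMeasure_apply_singleton _ _ (MeasurableSet.singleton a)]
    exact (ENNReal.div_mul_cancel' (h a) fun h' => absurd h' (q.apply_ne_top a)).symm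
  have hac : p.toMeasure.AbsolutelyContinuous q.toMeasure := by
    rw [hd]
    exact MeasureTheory.withDensity_absolutelyContinuous _ _
  have hrn : p.toMeasure.rnDeriv q.toMeasure =ᵐ[q.toMeasure] fun a => p a / q a := by
    conv_lhs => rw [hd]
    exact MeasureTheory.Measure.rnDeriv_withDensity _ (measurable_of_countable _)
  rw [InformationTheory.klDiv_eq_lintegral_klFun_of_ac hac,
    MeasureTheory.lintegral_congr_ae (g := fun a =>
      ENNReal.ofReal (InformationTheory.klFun (p a / q a).toReal))
      (hrn.mono fun a ha => by simp only [ha]),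
    MeasureTheory.lintegral_countable']
  refine tsum_congr fun a => ?_
  rw [PMF.toMeasure_apply_singleton _ _ (MeasurableSet.singleton a)]
  by_cases hq : q a = 0
  · simp [hq, h a hq, klTerm]
  have hq' : (q a).toReal ≠ 0 := (ENNReal.toReal_pos hq (q.apply_ne_top a)).ne'
  conv_lhs => enter [2]; rw [← ENNReal.ofReal_toReal (q.apply_ne_top a)]
  rw [← ENNReal.ofReal_mul' ENNReal.toReal_nonneg, klTerm, InformationTheory.klFun_apply,
    ENNReal.toReal_div]
  congr 1
  field_simp

end Divergence

/-! ### Entropies in nats and the chain rule -/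

section Nats

variable {α β : Type*}

/-- The natural logarithm of two, as an extended nonnegative real. -/
noncomputable abbrev ln2 : ℝ≥0∞ := ENNReal.ofReal (Real.log 2)

theorem ln2_ne_zero : ln2 ≠ 0 := by
  simpa [ln2] using Real.log_pos one_lt_two

theorem ln2_ne_top : ln2 ≠ ∞ := ENNReal.ofReal_ne_top

theorem mutualInfo_mul_ln2 [Countable α] [Countable β] (J : PMF (α × β)) :
    mutualInfo J * ln2
      = ∑' z, klTerm (J z) (J.map Prod.fst z.1 * J.map Prod.snd z.2) := by
  rw [mutualInfo, klBits, ENNReal.div_mul_cancel ln2_ne_zero ln2_ne_top, klDiv_toMeasure]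
  · simp_rw [indepLaw_apply]
  · intro z hz
    rw [indepLaw_apply, mul_eq_zero] at hz
    refine le_antisymm ?_ bot_le
    rcases hz with hz | hz
    · exact (apply_le_map J Prod.fst z).trans hz.le
    · exact (apply_le_map J Prod.snd z).trans hz.le

theorem entropy_mul_ln2 (p : PMF α) :
    entropy p * ln2 = ∑' a, p a * ENNReal.ofReal (-Real.log (p a).toReal) := by
  rw [entropy, ← ENNReal.tsum_mul_right]
  refine tsum_congr fun a => ?_
  conv_rhs => rw [← ENNReal.ofReal_toReal (p.apply_ne_top a)]
  rw [← ENNReal.ofReal_mul' (Real.log_pos one_lt_two).le,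
    ENNReal.toReal_ofReal ENNReal.toReal_nonneg, ← ENNReal.ofReal_mul ENNReal.toReal_nonneg]
  congr 1
  have := (Real.log_pos one_lt_two).ne'
  rw [Real.logb]
  field_simp

theorem condEntropy_mul_ln2 (J : PMF (α × β)) :
    condEntropy J * ln2
      = ∑' z, J z * ENNReal.ofReal (Real.log ((J.map Prod.fst z.1).toReal / (J z).toReal)) := by
  rw [condEntropy, ← ENNReal.tsum_mul_right]
  refine tsum_congr fun a => ?_
  conv_rhs => rw [← ENNReal.ofReal_toReal (J.apply_ne_top a)]
  rw [← ENNReal.ofReal_mul' (Real.log_pos one_lt_two).le,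
    ENNReal.toReal_ofReal ENNReal.toReal_nonneg, ← ENNReal.ofReal_mul ENNReal.toReal_nonneg,
    ← inv_div, Real.logb_inv]
  congr 1
  have := (Real.log_pos one_lt_two).ne'
  rw [Real.logb]
  field_simp

/-- The identity holds atom by atom once `J z` is added on one side and the product of the marginals
on the other, which keeps every term nonnegative. Both additions have total mass one and cancel, so
infinite entropies need no separate treatment. -/
theorem mutualInfo_add_condEntropy [Countable α] [Countable β] (J : PMF (α × β)) :
    mutualInfo J + condEntropy J = entropy (J.map Prod.snd) := by
  have key : ∀ z : α × β, klTerm (J z) (J.map Prod.fst z.1 * J.map Prod.snd z.2)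
      + J z * ENNReal.ofReal (Real.log ((J.map Prod.fst z.1).toReal / (J z).toReal)) + J z
      = J z * ENNReal.ofReal (-Real.log (J.map Prod.snd z.2).toReal)
        + J.map Prod.fst z.1 * J.map Prod.snd z.2 := by
    intro z
    set p := J.map Prod.fst z.1
    set q := J.map Prod.snd z.2
    have hp : J z ≤ p := apply_le_map J Prod.fst z
    have hq : J z ≤ q := apply_le_map J Prod.snd z
    have hpt : p ≠ ∞ := PMF.apply_ne_top _ _
    have hqt : q ≠ ∞ := PMF.apply_ne_top _ _
    have hq1 : q ≤ 1 := PMF.coe_le_one _ _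
    by_cases h0 : J z = 0
    · rw [h0, klTerm_zero_left _ (ENNReal.mul_ne_top hpt hqt)]
      simp
    have hJ : 0 < (J z).toReal := ENNReal.toReal_pos h0 (J.apply_ne_top z)
    have hp' : (J z).toReal ≤ p.toReal := ENNReal.toReal_mono hpt hp
    have hq' : (J z).toReal ≤ q.toReal := ENNReal.toReal_mono hqt hq
    have hq1' : q.toReal ≤ 1 := ENNReal.toReal_mono ENNReal.one_ne_top hq1
    have h1 : 0 ≤ Real.log (p.toReal / (J z).toReal) :=
      Real.log_nonneg ((one_le_div hJ).2 hp')
    have h2 : 0 ≤ -Real.log q.toReal := by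
      have := Real.log_nonpos ENNReal.toReal_nonneg hq1'
      linarith
    have h3 := klTerm_arg_nonneg hJ.le (b := p.toReal * q.toReal) (by positivity)
      fun h => absurd h (by have := hJ.trans_le hp'; have := hJ.trans_le hq'; positivity)
    rw [klTerm, ENNReal.toReal_mul]
    conv_lhs =>
      enter [2]; rw [← ENNReal.ofReal_toReal (J.apply_ne_top z)]
    conv_lhs =>
      enter [1, 2, 1]; rw [← ENNReal.ofReal_toReal (J.apply_ne_top z)]
    conv_rhs =>
      rw [← ENNReal.ofReal_toReal (J.apply_ne_top z), ← ENNReal.ofReal_toReal hpt,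
        ← ENNReal.ofReal_toReal hqt]
    simp only [ENNReal.toReal_ofReal ENNReal.toReal_nonneg]
    rw [← ENNReal.ofReal_mul hJ.le, ← ENNReal.ofReal_mul hJ.le,
      ← ENNReal.ofReal_mul ENNReal.toReal_nonneg, ← ENNReal.ofReal_add h3 (by positivity),
      ← ENNReal.ofReal_add (by positivity) hJ.le, ← ENNReal.ofReal_add (by positivity) (by positivity)]
    congr 1
    have hp0 := (hJ.trans_le hp').ne'
    have hq0 := (hJ.trans_le hq').ne'
    rw [Real.log_div hJ.ne' (mul_ne_zero hp0 hq0), Real.log_mul hp0 hq0, Real.log_div hp0 hJ.ne']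
    ring
  have hsum := congrArg (fun f : α × β → ℝ≥0∞ => ∑' z, f z) (funext key)
  simp only [ENNReal.tsum_add] at hsum
  rw [PMF.tsum_coe, tsum_indep_mul, ENNReal.add_left_inj ENNReal.one_ne_top,
    ← mutualInfo_mul_ln2, ← condEntropy_mul_ln2,
    ← tsum_map_mul J Prod.snd (fun b => ENNReal.ofReal (-Real.log (J.map Prod.snd b).toReal)),
    ← entropy_mul_ln2, ← add_mul] at hsum
  exact (ENNReal.mul_left_inj ln2_ne_zero ln2_ne_top).1 hsum

theorem mutualInfo_swap [Countable α] [Countable β] (J : PMF (α × β)) :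
    mutualInfo (J.map Prod.swap) = mutualInfo J := by
  rw [← ENNReal.mul_left_inj ln2_ne_zero ln2_ne_top, mutualInfo_mul_ln2, mutualInfo_mul_ln2,
    map_fst_swap, map_snd_swap, ← (Equiv.prodComm α β).tsum_eq]
  refine tsum_congr fun z => ?_
  rw [mul_comm (J.map Prod.snd _)]
  congr 1
  exact map_apply_injective J Prod.swap_injective z

theorem entropy_ne_top [Finite α] (p : PMF α) : entropy p ≠ ∞ := by
  have := Fintype.ofFinite α
  rw [entropy, tsum_fintype]
  exact ENNReal.sum_ne_top.2 fun a _ => ENNReal.ofReal_ne_top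

theorem mutualInfo_eq_zero_of_indep [Countable α] [Countable β] {J : PMF (α × β)}
    {p : PMF α} {q : PMF β} (h : ∀ z, J z = p z.1 * q z.2) : mutualInfo J = 0 := by
  have h1 : J.map Prod.fst = p := PMF.ext fun a => by
    rw [map_fst_apply]; simp_rw [h]; rw [ENNReal.tsum_mul_left, PMF.tsum_coe, mul_one]
  have h2 : J.map Prod.snd = q := PMF.ext fun a => by
    rw [map_snd_apply]; simp_rw [h]; rw [ENNReal.tsum_mul_right, PMF.tsum_coe, one_mul]
  rw [← ENNReal.mul_left_inj ln2_ne_zero ln2_ne_top, mutualInfo_mul_ln2, h1, h2]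
  simp_rw [h, klTerm_self]
  simp

end Nats

/-! ### Exponential clocks and the law of a race -/

section Race

open MeasureTheory Filter Topology Set

theorem lintegral_Ioi_ofReal_deriv {g g' : ℝ → ℝ} {a l : ℝ}
    (hderiv : ∀ x ∈ Ici a, HasDerivAt g (g' x) x) (hpos : ∀ x ∈ Ioi a, 0 ≤ g' x)
    (hg : Tendsto g atTop (𝓝 l)) :
    ∫⁻ x in Ioi a, ENNReal.ofReal (g' x) = ENNReal.ofReal (l - g a) := by
  rw [← ofReal_integral_eq_lintegral_ofReal, integral_Ioi_of_hasDerivAt_of_nonneg' hderiv hpos hg]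
  · exact integrableOn_Ioi_deriv_of_nonneg' hderiv hpos hg
  · exact (ae_restrict_iff' measurableSet_Ioi).2 (ae_of_all _ hpos)

/-- The exponential distribution of mean one. -/
noncomputable def expLaw : Measure ℝ :=
  (volume.restrict (Ioi 0)).withDensity fun s => ENNReal.ofReal (Real.exp (-s))

theorem lintegral_expLaw {f : ℝ → ℝ≥0∞} (hf : Measurable f) :
    ∫⁻ s, f s ∂expLaw = ∫⁻ s in Ioi 0, f s * ENNReal.ofReal (Real.exp (-s)) := by
  rw [expLaw, lintegral_withDensity_eq_lintegral_mul _ (by fun_prop) hf]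
  simp [mul_comm]

theorem lintegral_affine_mul_exp {A B b : ℝ} (hA : 0 ≤ A) (hB : 0 ≤ B) (hb : 0 < b) {t : ℝ}
    (ht : 0 ≤ t) :
    ∫⁻ s in Ioi t, ENNReal.ofReal ((A + B * s) * Real.exp (-(b * s)))
      = ENNReal.ofReal ((A / b + B / b ^ 2 + B / b * t) * Real.exp (-(b * t))) := by
  have hd : ∀ s ∈ Ici t, HasDerivAt
      (fun s => -((A / b + B / b ^ 2 + B / b * s) * Real.exp (-(b * s))))
      ((A + B * s) * Real.exp (-(b * s))) s := by
    intro s _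
    have h1 : HasDerivAt (fun s : ℝ => Real.exp (-(b * s))) (Real.exp (-(b * s)) * (-(b * 1))) s :=
      ((hasDerivAt_id s).const_mul b).neg.exp
    have h2 : HasDerivAt (fun s : ℝ => A / b + B / b ^ 2 + B / b * s) (B / b * 1) s :=
      ((hasDerivAt_id s).const_mul (B / b)).const_add _
    convert! (h2.mul h1).neg using 1
    field_simp
    ring
  rw [lintegral_Ioi_ofReal_deriv (l := 0) hd]
  · simp
  · intro s hs
    have : 0 < s := ht.trans_lt hs
    positivity
  · have h0 := tendsto_rpow_mul_exp_neg_mul_atTop_nhds_zero 0 b hb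
    have h1 := tendsto_rpow_mul_exp_neg_mul_atTop_nhds_zero 1 b hb
    have := ((h0.const_mul (A / b + B / b ^ 2)).add (h1.const_mul (B / b))).neg
    simp only [mul_zero, add_zero, neg_zero, Real.rpow_zero, Real.rpow_one, one_mul] at this
    refine this.congr fun s => ?_
    rw [neg_mul]
    ring

theorem expLaw_Ioi {t : ℝ} (ht : 0 ≤ t) : expLaw (Ioi t) = ENNReal.ofReal (Real.exp (-t)) := by
  rw [expLaw, withDensity_apply _ measurableSet_Ioi, Measure.restrict_restrict measurableSet_Ioi,
    Ioi_inter_Ioi, sup_eq_left.2 ht]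
  have := lintegral_affine_mul_exp (A := 1) (B := 0) (b := 1) zero_le_one le_rfl one_pos ht
  simpa using this

instance : IsProbabilityMeasure expLaw := ⟨by
  have : expLaw (Iic 0) = 0 := by
    rw [expLaw, withDensity_apply _ measurableSet_Iic, Measure.restrict_restrict measurableSet_Iic]
    rw [inter_comm, Ioi_inter_Iic, Ioc_self]
    simp
  rw [← Iic_union_Ioi (a := (0 : ℝ)), measure_union (by simp) measurableSet_Ioi, this,
    expLaw_Ioi le_rfl]
  simp⟩

variable {ι : Type*}

/-- Independent exponential clocks of rate one. -/
noncomputable def clocks (ι : Type*) : Measure (ι → ℝ) := Measure.infinitePi fun _ : ι => expLaw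

instance : IsProbabilityMeasure (clocks ι) := by unfold clocks; infer_instance

theorem lintegral_clocks_eval {f : ℝ → ℝ≥0∞} (hf : Measurable f) (y : ι) :
    ∫⁻ ω, f (ω y) ∂clocks ι = ∫⁻ s, f s ∂expLaw := by
  have h := Measure.infinitePi_map_eval (fun _ : ι => expLaw) y
  conv_rhs => rw [← h]
  rw [lintegral_map hf (measurable_pi_apply y)]
  rfl

/-- The event that clock `y`, with time scaled by `c i` against clock `i`, beats all clocks in a
set. -/
def winSet (c : ι → ℝ) (y : ι) (T : Set ι) : Set (ι → ℝ) :=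
  {ω | ∀ i ∈ T, i ≠ y → c i * ω y < ω i}

theorem measurableSet_winSet (c : ι → ℝ) (y : ι) {T : Set ι} (hT : T.Countable) :
    MeasurableSet (winSet c y T) := by
  have : winSet c y T = ⋂ i ∈ T, {ω | i ≠ y → c i * ω y < ω i} := by
    ext ω; simp [winSet]
  rw [this]
  refine MeasurableSet.biInter hT fun i _ => ?_
  by_cases h : i = y
  · simp [h]
  · simp only [ne_eq, h, not_false_eq_true, forall_const]
    exact measurableSet_lt (by fun_prop) (by fun_prop)

/-- Given `ω y = s`, clock `i` exceeds `c i * s` with probability `exp (-(c i * s))`, independently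
over `i`, so the rates add up. -/
theorem setLIntegral_winSet_finset {c : ι → ℝ} (hc : ∀ i, 0 ≤ c i) {y : ι} (hcy : c y = 1)
    (T : Finset ι) (hy : y ∈ T) {φ : ℝ → ℝ≥0∞} (hφ : Measurable φ) :
    ∫⁻ ω in winSet c y T, φ (ω y) ∂clocks ι
      = ∫⁻ s in Ioi 0, φ s * ENNReal.ofReal (Real.exp (-((∑ i ∈ T, c i) * s))) := by
  classical
  set R : Finset ι := T.erase y
  have hind : ProbabilityTheory.IndepFun (fun ω : ι → ℝ => ω y) (fun ω (i : R) => ω i)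
      (clocks ι) := by
    have h := (ProbabilityTheory.iIndepFun_infinitePi (P := fun _ : ι => expLaw)
      (X := fun _ ω => ω) (fun _ => measurable_id)).indepFun_finset {y} R (by simp [R])
      (fun i => by fun_prop)
    exact h.comp (φ := fun v : ({y} : Finset ι) → ℝ => v ⟨y, by simp⟩) (ψ := id)
      (measurable_pi_apply _) measurable_id
  have hmeas2 : Measurable fun (ω : ι → ℝ) (i : R) => ω i := by fun_prop
  have hmap := (ProbabilityTheory.indepFun_iff_map_prod_eq_prod_map_map
    (measurable_pi_apply y).aemeasurable hmeas2.aemeasurable).1 hind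
  let D : Set (ℝ × (R → ℝ)) := {z | ∀ i : R, c i * z.1 < z.2 i}
  have hD : MeasurableSet D := by
    have : D = ⋂ i : R, {z | c i * z.1 < z.2 i} := by ext; simp [D]
    rw [this]
    exact MeasurableSet.iInter fun i => measurableSet_lt (by fun_prop) (by fun_prop)
  have hv : ∀ s : ℝ, MeasurableSet {v : R → ℝ | ∀ i : R, c i * s < v i} := by
    intro s
    have : {v : R → ℝ | ∀ i : R, c i * s < v i} = ⋂ i : R, {v | c i * s < v i} := by ext; simp
    rw [this]
    exact MeasurableSet.iInter fun i => measurableSet_lt (by fun_prop) (by fun_prop)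
  have hpre : winSet c y T = (fun ω : ι → ℝ => (ω y, fun i : R => ω i)) ⁻¹' D := by
    ext ω
    simp only [winSet, D, R, mem_ofPred_eq, mem_preimage, Subtype.forall, Finset.mem_erase,
      Finset.mem_coe]
    exact ⟨fun h i hi => h i hi.2 hi.1, fun h i hi hi' => h i ⟨hi', hi⟩⟩
  have hev : (clocks ι).map (fun ω => ω y) = expLaw :=
    Measure.infinitePi_map_eval (fun _ : ι => expLaw) y
  have : IsProbabilityMeasure ((clocks ι).map fun ω (i : R) => ω i) :=
    Measure.isProbabilityMeasure_map hmeas2.aemeasurable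
  have hmeasφ : Measurable (D.indicator fun z => φ z.1) := by
    exact (hφ.comp measurable_fst).indicator hD
  calc ∫⁻ ω in winSet c y T, φ (ω y) ∂clocks ι
      = ∫⁻ ω, D.indicator (fun z => φ z.1) (ω y, fun i : R => ω i) ∂clocks ι := by
        rw [← lintegral_indicator (measurableSet_winSet c y T.countable_toSet), hpre]
        rfl
    _ = ∫⁻ z, D.indicator (fun z => φ z.1) z
          ∂(expLaw.prod ((clocks ι).map fun ω (i : R) => ω i)) := by
        rw [← hev, ← hmap, lintegral_map hmeasφ (by fun_prop)]
    _ = ∫⁻ s, φ s * ((clocks ι).map fun ω (i : R) => ω i) {v | ∀ i : R, c i * s < v i} ∂expLaw := by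
        rw [lintegral_prod _ hmeasφ.aemeasurable]
        refine lintegral_congr fun s => ?_
        rw [← lintegral_indicator_const]
        · rfl
        · exact hv s
    _ = ∫⁻ s, φ s * ∏ i ∈ R, expLaw (Ioi (c i * s)) ∂expLaw := by
        refine lintegral_congr fun s => ?_
        rw [Measure.map_apply hmeas2, ← Measure.infinitePi_pi (fun _ : ι => expLaw)
          fun i _ => measurableSet_Ioi]
        · congr 2
          ext ω
          simp [Set.mem_pi]
        · exact hv s
    _ = ∫⁻ s in Ioi 0, φ s * (∏ i ∈ R, expLaw (Ioi (c i * s))) * ENNReal.ofReal (Real.exp (-s)) := by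
        refine lintegral_expLaw (hφ.mul (Finset.measurable_prod _ fun i _ => ?_))
        have : Antitone fun s => expLaw (Ioi (c i * s)) := fun s t hst =>
          measure_mono (Ioi_subset_Ioi (mul_le_mul_of_nonneg_left hst (hc i)))
        exact this.measurable
    _ = _ := by
        -- The density `exp (-s)` of clock `y` itself supplies the missing summand `c y = 1`.
        refine setLIntegral_congr_fun measurableSet_Ioi fun s hs => ?_
        rw [mul_assoc, Finset.prod_congr rfl fun i _ =>
          expLaw_Ioi (mul_nonneg (hc i) (le_of_lt hs)),
          ← ENNReal.ofReal_prod_of_nonneg (fun i _ => (Real.exp_pos _).le),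
          ← ENNReal.ofReal_mul (by positivity), ← Real.exp_sum, ← Real.exp_add,
          ← Finset.add_sum_erase T c hy, hcy, Finset.sum_neg_distrib, ← Finset.sum_mul]
        congr 3
        ring

theorem setLIntegral_winSet_affine_finset {c : ι → ℝ} (hc : ∀ i, 0 ≤ c i) {y : ι} (hcy : c y = 1)
    (T : Finset ι) (hy : y ∈ T) {A B : ℝ} (hA : 0 ≤ A) (hB : 0 ≤ B) :
    ∫⁻ ω in winSet c y T, ENNReal.ofReal (A + B * ω y) ∂clocks ι
      = ENNReal.ofReal (A / (∑ i ∈ T, c i) + B / (∑ i ∈ T, c i) ^ 2) := by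
  have hpos : 0 < ∑ i ∈ T, c i :=
    lt_of_lt_of_le (by rw [hcy]; exact one_pos) (Finset.single_le_sum (fun i _ => hc i) hy)
  rw [setLIntegral_winSet_finset hc hcy T hy (φ := fun s => ENNReal.ofReal (A + B * s))
    (by fun_prop)]
  have := lintegral_affine_mul_exp hA hB hpos le_rfl
  simp only [mul_zero, add_zero, neg_zero, Real.exp_zero, mul_one] at this
  rw [← this]
  refine setLIntegral_congr_fun measurableSet_Ioi fun s hs => ?_
  rw [ENNReal.ofReal_mul]
  have : 0 < s := hs
  positivity

theorem tendsto_ofReal_affine {c : ι → ℝ} (hc : ∀ i, 0 ≤ c i) {y : ι} (hcy : c y = 1) {S : ℝ}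
    (hS : HasSum c S) (A B : ℝ) :
    Tendsto (fun T : Finset ι => ENNReal.ofReal (A / (∑ i ∈ T, c i) + B / (∑ i ∈ T, c i) ^ 2))
      atTop (𝓝 (ENNReal.ofReal (A / S + B / S ^ 2))) := by
  have hSpos : 0 < S := lt_of_lt_of_le (by rw [hcy]; exact one_pos) (le_hasSum hS y fun i _ => hc i)
  refine ENNReal.tendsto_ofReal (Tendsto.add ?_ ?_)
  · exact tendsto_const_nhds.div hS hSpos.ne'
  · exact tendsto_const_nhds.div (hS.pow 2) (by positivity)

/-- Beating all clocks is contained in beating finitely many, so the inequality needs only the limit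
of the explicit values, not of the events. -/
theorem setLIntegral_winSet_le {c : ι → ℝ} (hc : ∀ i, 0 ≤ c i) {y : ι} (hcy : c y = 1) {S : ℝ}
    (hS : HasSum c S) {A B : ℝ} (hA : 0 ≤ A) (hB : 0 ≤ B) :
    ∫⁻ ω in winSet c y univ, ENNReal.ofReal (A + B * ω y) ∂clocks ι
      ≤ ENNReal.ofReal (A / S + B / S ^ 2) := by
  refine ge_of_tendsto (tendsto_ofReal_affine hc hcy hS A B)
    ((eventually_ge_atTop {y}).mono fun T hT => ?_)
  rw [← setLIntegral_winSet_affine_finset hc hcy T (by simpa using hT) hA hB]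
  exact lintegral_mono_set fun ω h i _ hi => h i (mem_univ i) hi

/-- Continuity from above along the finite subsets of competitors. -/
theorem clocks_winSet [Countable ι] {c : ι → ℝ} (hc : ∀ i, 0 ≤ c i) {y : ι} (hcy : c y = 1) {S : ℝ}
    (hS : HasSum c S) : clocks ι (winSet c y univ) = ENNReal.ofReal (1 / S) := by
  have hInter : winSet c y univ = ⋂ T : Finset ι, winSet c y T := by
    ext ω
    simp only [winSet, mem_univ, true_imp_iff, mem_ofPred_eq, mem_iInter, Finset.mem_coe]
    exact ⟨fun h _ i _ hi => h i hi, fun h i hi => h {i} i (by simp) hi⟩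
  have h1 : Tendsto (fun T : Finset ι => clocks ι (winSet c y T)) atTop
      (𝓝 (clocks ι (winSet c y univ))) := by
    rw [hInter]
    refine tendsto_measure_iInter_atTop
      (fun T => (measurableSet_winSet c y T.countable_toSet).nullMeasurableSet)
      (fun T T' h ω hω i hi => hω i (h hi)) ⟨∅, measure_ne_top _ _⟩
  refine tendsto_nhds_unique h1 (Tendsto.congr' ?_
    (by simpa using tendsto_ofReal_affine hc hcy hS 1 0))
  filter_upwards [eventually_ge_atTop {y}] with T hT
  have := setLIntegral_winSet_affine_finset hc hcy T (by simpa using hT) zero_le_one le_rfl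
  simpa using this.symm

end Race

/-! ### Coupling the conditional laws through one race -/

section Coupling

open MeasureTheory Set

variable {𝒳 𝒴 : Type*}

/-- Gibbs' inequality for the law of `u(X)` against an unnormalized weight `v`: the `1` and the sum
of `v` are the two total masses. Leaving `v` unnormalized allows weights that depend on the clocks
and have mass at most one only on average. -/
theorem gibbs_map (π : PMF 𝒳) (u : 𝒳 → 𝒴) (v : 𝒴 → ℝ)  (hv : ∀ x, 0 < v (u x)) :
    ∑' x, π x * ENNReal.ofReal (-Real.log (π.map u (u x)).toReal) + 1
      ≤ ∑' x, π x * ENNReal.ofReal (-Real.log (v (u x))) + ∑' y, ENNReal.ofReal (v y) := by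
  rw [← tsum_map_mul π u fun y => ENNReal.ofReal (-Real.log (π.map u y).toReal),
    ← tsum_map_mul π u fun y => ENNReal.ofReal (-Real.log (v y)), ← PMF.tsum_coe (π.map u),
    ← ENNReal.tsum_add, ← ENNReal.tsum_add]
  refine ENNReal.tsum_le_tsum fun y => ?_
  set ν := π.map u y with hν
  have hνt : ν ≠ ∞ := PMF.apply_ne_top _ _
  by_cases h0 : ν = 0
  · simp [h0]
  have hvy : 0 < v y := by
    by_contra h
    refine h0 (map_apply_eq_zero _ _ ?_)
    rintro ⟨x, rfl⟩
    exact h (hv x)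
  have hpos : 0 < ν.toReal := ENNReal.toReal_pos h0 hνt
  have h1 : ν.toReal ≤ 1 := ENNReal.toReal_mono ENNReal.one_ne_top (PMF.coe_le_one _ _)
  have hl : 0 ≤ -Real.log ν.toReal := by linarith [Real.log_nonpos hpos.le h1]
  have hk := klTerm_arg_nonneg hpos.le hvy.le fun h => absurd h hvy.ne'
  rw [Real.log_div hpos.ne' hvy.ne'] at hk
  have e : ν = ENNReal.ofReal ν.toReal := (ENNReal.ofReal_toReal hνt).symm
  rw [e, ENNReal.toReal_ofReal hpos.le, ← ENNReal.ofReal_mul hpos.le, ← ENNReal.ofReal_mul hpos.le,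
    ← ENNReal.ofReal_add (mul_nonneg hpos.le hl) hpos.le]
  refine le_trans (ENNReal.ofReal_le_ofReal ?_) ENNReal.ofReal_add_le
  linarith

theorem ae_clocks_pos {ι : Type*} (y : ι) : ∀ᵐ ω ∂clocks ι, 0 < ω y := by
  have h : ∀ᵐ s ∂expLaw, 0 < s :=
    (mem_ae_iff_prob_eq_one measurableSet_Ioi).2 (by simpa using expLaw_Ioi (le_refl 0))
  have hm : (clocks ι).map (fun ω => ω y) = expLaw :=
    Measure.infinitePi_map_eval (fun _ : ι => expLaw) y
  rw [← hm] at h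
  exact ae_of_ae_map (measurable_pi_apply y).aemeasurable h

/-- Exponential race: the event that symbol `y` is selected by input `x`. -/
def winner (p : 𝒳 → PMF 𝒴) (x : 𝒳) (y : 𝒴) : Set (𝒴 → ℝ) :=
  {ω | p x y ≠ 0 ∧ ω ∈ winSet (fun i => (p x i).toReal / (p x y).toReal) y univ}

theorem winner_of_eq_zero {p : 𝒳 → PMF 𝒴} {x : 𝒳} {y : 𝒴} (h : p x y = 0) : winner p x y = ∅ := by
  ext ω; simp [winner, h]

theorem winner_of_ne_zero {p : 𝒳 → PMF 𝒴} {x : 𝒳} {y : 𝒴} (h : p x y ≠ 0) :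
    winner p x y = winSet (fun i => (p x i).toReal / (p x y).toReal) y univ := by
  ext ω; simp [winner, h]

theorem measurableSet_winner [Countable 𝒴] (p : 𝒳 → PMF 𝒴) (x : 𝒳) (y : 𝒴) :
    MeasurableSet (winner p x y) := by
  by_cases h : p x y = 0
  · simp [winner_of_eq_zero h]
  · rw [winner_of_ne_zero h]
    exact measurableSet_winSet _ _ countable_univ

theorem hasSum_toReal (p : PMF 𝒴) : HasSum (fun y => (p y).toReal) 1 := by
  have := ENNReal.hasSum_toReal p.tsum_coe_ne_top
  rwa [← ENNReal.tsum_toReal_eq fun y => p.apply_ne_top y, PMF.tsum_coe] at this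

/-- The rates relative to `y` add up to `1 / p x y`, and the winning probability is the reciprocal.
-/
theorem clocks_winner [Countable 𝒴] (p : 𝒳 → PMF 𝒴) (x : 𝒳) (y : 𝒴) :
    clocks 𝒴 (winner p x y) = p x y := by
  by_cases h : p x y = 0
  · simp [winner_of_eq_zero h, h]
  have hp := ENNReal.toReal_pos h ((p x).apply_ne_top y)
  rw [winner_of_ne_zero h, clocks_winSet (c := fun i => (p x i).toReal / (p x y).toReal)
      (S := 1 / (p x y).toReal) (fun i => by positivity)
    (div_self hp.ne') ((hasSum_toReal (p x)).div_const _), one_div_one_div,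
    ENNReal.ofReal_toReal ((p x).apply_ne_top y)]

theorem eq_of_mem_winner {p : 𝒳 → PMF 𝒴} {x : 𝒳} {y y' : 𝒴} {ω : 𝒴 → ℝ}
    (h : ω ∈ winner p x y) (h' : ω ∈ winner p x y') : y = y' := by
  by_contra hne
  have hp := ENNReal.toReal_pos h.1 ((p x).apply_ne_top y)
  have hp' := ENNReal.toReal_pos h'.1 ((p x).apply_ne_top y')
  have h1 := h.2 y' (mem_univ _) (Ne.symm hne)
  have h2 := h'.2 y (mem_univ _) hne
  simp only at h1 h2
  rw [div_mul_eq_mul_div, div_lt_iff₀ hp] at h1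
  rw [div_mul_eq_mul_div, div_lt_iff₀ hp'] at h2
  linarith

theorem ae_exists_mem_winner [Countable 𝒴] (p : 𝒳 → PMF 𝒴) (x : 𝒳) :
    ∀ᵐ ω ∂clocks 𝒴, ∃ y, ω ∈ winner p x y := by
  have h : clocks 𝒴 (⋃ y, winner p x y) = 1 := by
    rw [measure_iUnion _ fun y => measurableSet_winner p x y]
    · simp_rw [clocks_winner, PMF.tsum_coe]
    · intro y y' hne
      exact disjoint_left.2 fun ω h h' => hne (eq_of_mem_winner h h')
  have := (prob_compl_eq_zero_iff (MeasurableSet.iUnion fun y => measurableSet_winner p x y)).2 h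
  filter_upwards [measure_eq_zero_iff_ae_notMem.1 this] with ω hω
  simpa using hω

/-- The event that input `x` selects `u x`, for every `x`. -/
def winners (p : 𝒳 → PMF 𝒴) (u : 𝒳 → 𝒴) : Set (𝒴 → ℝ) := ⋂ x, winner p x (u x)

variable [Finite 𝒳] [Countable 𝒴]

theorem measurableSet_winners (p : 𝒳 → PMF 𝒴) (u : 𝒳 → 𝒴) : MeasurableSet (winners p u) :=
  MeasurableSet.iInter fun x => measurableSet_winner p x (u x)

/-- Almost surely every input has exactly one winner, so the events `winners p u` partition the
space up to a null set. There are possibly uncountably many inputs to an almost-sure statement only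
if `𝒳` is infinite; finiteness makes the intersection over `x` harmless. -/
theorem tsum_setLIntegral_winners_inter (p : 𝒳 → PMF 𝒴) {W : Set (𝒴 → ℝ)} (hW : MeasurableSet W)
    (f : (𝒴 → ℝ) → ℝ≥0∞) :
    ∑' u, ∫⁻ ω in winners p u ∩ W, f ω ∂clocks 𝒴 = ∫⁻ ω in W, f ω ∂clocks 𝒴 := by
  rw [← lintegral_iUnion (fun u => (measurableSet_winners p u).inter hW)]
  · refine setLIntegral_congr ?_
    have : ∀ᵐ ω ∂clocks 𝒴, ∀ x, ∃ y, ω ∈ winner p x y :=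
      ae_all_iff.2 fun x => ae_exists_mem_winner p x
    filter_upwards [this] with ω hω
    choose u hu using hω
    refine propext ⟨fun h => ?_, fun h => ?_⟩
    · obtain ⟨u, hu⟩ := mem_iUnion.1 h
      exact hu.2
    · exact mem_iUnion.2 ⟨u, mem_iInter.2 hu, h⟩
  · intro u u' hne
    refine disjoint_left.2 fun ω h h' => hne (funext fun x => ?_)
    exact eq_of_mem_winner (mem_iInter.1 h.1 x) (mem_iInter.1 h'.1 x)

theorem tsum_setLIntegral_winners (p : 𝒳 → PMF 𝒴) (x : 𝒳) (g : 𝒴 → (𝒴 → ℝ) → ℝ≥0∞) :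
    ∑' u, ∫⁻ ω in winners p u, g (u x) ω ∂clocks 𝒴
      = ∑' y, ∫⁻ ω in winner p x y, g y ω ∂clocks 𝒴 := by
  simp_rw [← fun y => tsum_setLIntegral_winners_inter p (measurableSet_winner p x y) (g y)]
  rw [ENNReal.tsum_comm]
  refine tsum_congr fun u => ?_
  rw [tsum_eq_single (u x)]
  · rw [inter_eq_left.2 (show winners p u ⊆ winner p x (u x) from iInter_subset _ x)]
  · intro y hy
    have : winners p u ∩ winner p x y = ∅ := by
      refine eq_empty_of_forall_notMem fun ω hω => hy ?_
      exact eq_of_mem_winner hω.2 (mem_iInter.1 hω.1 x)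
    simp [this]

/-- The joint law of the symbols selected by the inputs in the exponential race. -/
noncomputable def raceLaw (p : 𝒳 → PMF 𝒴) : PMF (𝒳 → 𝒴) :=
  ⟨fun u => clocks 𝒴 (winners p u), by
    have := tsum_setLIntegral_winners_inter p MeasurableSet.univ fun _ => 1
    simp only [inter_univ, lintegral_one, Measure.restrict_apply_univ, measure_univ] at this
    exact this ▸ ENNReal.summable.hasSum⟩

theorem raceLaw_apply (p : 𝒳 → PMF 𝒴) (u : 𝒳 → 𝒴) :
    raceLaw p u = clocks 𝒴 (winners p u) := rfl

theorem tsum_raceLaw_mul (p : 𝒳 → PMF 𝒴) (x : 𝒳) (g : 𝒴 → ℝ≥0∞) :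
    ∑' u, raceLaw p u * g (u x) = ∑' y, p x y * g y := by
  have := tsum_setLIntegral_winners p x fun y _ => g y
  simp only [lintegral_const, Measure.restrict_apply_univ, clocks_winner] at this
  simpa only [raceLaw_apply, mul_comm] using this

/-- Let `y` race against the larger of the two relative rates of each competitor. These rates are
still summable, so `y` wins with positive probability, and then it wins for `x` and for `x'` at
once. -/
theorem exists_raceLaw_ne_zero (p : 𝒳 → PMF 𝒴) {x x' : 𝒳} {y : 𝒴} (h : p x y ≠ 0)
    (h' : p x' y ≠ 0) : ∃ u, raceLaw p u ≠ 0 ∧ u x = y ∧ u x' = y := by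
  have hp := ENNReal.toReal_pos h ((p x).apply_ne_top y)
  have hp' := ENNReal.toReal_pos h' ((p x').apply_ne_top y)
  let c : 𝒴 → ℝ := fun i => max ((p x i).toReal / (p x y).toReal) ((p x' i).toReal / (p x' y).toReal)
  have hc : ∀ i, 0 ≤ c i := fun i => le_max_of_le_left (by positivity)
  have hcy : c y = 1 := by simp [c, hp.ne', hp'.ne']
  have hsum : Summable c := by
    refine Summable.of_nonneg_of_le hc (fun i => max_le_add_of_nonneg ?_ ?_)
      (((hasSum_toReal (p x)).div_const _).summable.add
        ((hasSum_toReal (p x')).div_const _).summable)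
    · positivity
    · positivity
  have hpos : 0 < ∑' i, c i := hsum.tsum_pos hc y (by rw [hcy]; exact one_pos)
  have hW := clocks_winSet hc hcy hsum.hasSum
  have hWm : MeasurableSet (winSet c y univ) := measurableSet_winSet _ _ countable_univ
  have hint := tsum_setLIntegral_winners_inter p hWm fun _ => 1
  simp only [lintegral_one, Measure.restrict_apply_univ, hW] at hint
  obtain ⟨u, hu⟩ : ∃ u, clocks 𝒴 (winners p u ∩ winSet c y univ) ≠ 0 := by
    by_contra! hcon
    simp only [hcon, tsum_zero] at hint
    have : 0 < ENNReal.ofReal (1 / ∑' i, c i) := ENNReal.ofReal_pos.2 (by positivity)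
    exact this.ne hint
  refine ⟨u, fun h0 => hu (measure_mono_null inter_subset_left h0), ?_⟩
  -- Positivity of `ω y` lets the maximum of the rates dominate each rate after multiplication by `ω
  -- y`.
  obtain ⟨ω, ⟨hω, hωW⟩, hωpos⟩ : ∃ ω ∈ winners p u ∩ winSet c y univ, 0 < ω y := by
    by_contra! hcon
    refine hu (measure_mono_null (t := {ω | ¬ 0 < ω y}) (fun ω h => not_lt.2 (hcon ω h)) ?_)
    exact ae_iff.1 (ae_clocks_pos y)
  refine ⟨eq_of_mem_winner (mem_iInter.1 hω x) ⟨h, fun i _ hi => ?_⟩,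
    eq_of_mem_winner (mem_iInter.1 hω x') ⟨h', fun i _ hi => ?_⟩⟩
  · exact (mul_le_mul_of_nonneg_right (le_max_left _ _) hωpos.le).trans_lt (hωW i (mem_univ i) hi)
  · exact (mul_le_mul_of_nonneg_right (le_max_right _ _) hωpos.le).trans_lt (hωW i (mem_univ i) hi)

end Coupling

/-! ### Entropy bound from arrival times -/

section RaceEntropy

open MeasureTheory Set Filter Topology

variable {𝒳 𝒴 : Type*}

/-- Weight of a symbol whose first arrival time (at rate `q`) is `s / q`. -/
noncomputable def arrivalWeight (M q s : ℝ) : ℝ :=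
  if q = 0 then 0 else M⁻¹ * (1 + max s 0 / q) ^ (-(1 + M⁻¹))

theorem measurable_arrivalWeight (M q : ℝ) : Measurable (arrivalWeight M q) := by
  unfold arrivalWeight
  split_ifs
  · exact measurable_const
  · fun_prop

theorem arrivalWeight_pos {M q : ℝ} (hM : 0 < M) (hq : 0 < q) (s : ℝ) :
    0 < arrivalWeight M q s := by
  rw [arrivalWeight, if_neg hq.ne']
  have : 0 ≤ max s 0 / q := div_nonneg (le_max_right _ _) hq.le
  positivity

theorem neg_log_arrivalWeight {M q : ℝ} (hM : 0 < M) (hq : 0 < q) (s : ℝ) :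
    -Real.log (arrivalWeight M q s)
      = Real.log M + (1 + M⁻¹) * Real.log (1 + max s 0 / q) := by
  have : 0 ≤ max s 0 / q := div_nonneg (le_max_right _ _) hq.le
  rw [arrivalWeight, if_neg hq.ne', Real.log_mul (by positivity) (by positivity), Real.log_inv,
    Real.log_rpow (by positivity)]
  ring

/-- The arrival time `s / q` has density at most `q`, and `M⁻¹ * (1 + τ) ^ (-(1 + M⁻¹))` integrates
to one over `τ > 0`. Summed over `y`, the weights therefore have expected mass at most one. -/
theorem lintegral_arrivalWeight_le {M q : ℝ} (hM : 0 < M) (hq : 0 ≤ q) (ι : Type*) (y : ι) :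
    ∫⁻ ω, ENNReal.ofReal (arrivalWeight M q (ω y)) ∂clocks ι ≤ ENNReal.ofReal q := by
  rcases hq.eq_or_lt with rfl | hq
  · simp [arrivalWeight]
  rw [lintegral_clocks_eval (f := fun s => ENNReal.ofReal (arrivalWeight M q s))
    (measurable_arrivalWeight M q).ennreal_ofReal,
    lintegral_expLaw (measurable_arrivalWeight M q).ennreal_ofReal]
  have hd : ∀ s ∈ Ici (0 : ℝ), HasDerivAt (fun s => -(q * (1 + s / q) ^ (-M⁻¹)))
      (M⁻¹ * (1 + s / q) ^ (-(1 + M⁻¹))) s := by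
    intro s hs
    have hs : (0 : ℝ) ≤ s := hs
    have h1 : HasDerivAt (fun s : ℝ => 1 + s / q) (1 / q) s :=
      ((hasDerivAt_id s).div_const q).const_add 1
    have h2 := ((h1.rpow_const (p := -M⁻¹) (Or.inl (by positivity))).const_mul q).neg
    convert! h2 using 1
    rw [show -M⁻¹ - 1 = -(1 + M⁻¹) by ring]
    field_simp
  have hlim : Tendsto (fun s => -(q * (1 + s / q) ^ (-M⁻¹))) atTop (𝓝 0) := by
    have h1 : Tendsto (fun s : ℝ => 1 + s / q) atTop atTop :=
      tendsto_atTop_add_const_left _ _ (tendsto_id.atTop_div_const hq)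
    have := (((tendsto_rpow_neg_atTop (inv_pos.2 hM)).comp h1).const_mul q).neg
    simpa using this
  have hI := lintegral_Ioi_ofReal_deriv hd (fun s hs => by
    have : (0 : ℝ) < s := hs
    positivity) hlim
  simp only [zero_div, add_zero, Real.one_rpow, mul_one, sub_neg_eq_add, zero_add] at hI
  rw [← hI]
  refine setLIntegral_mono' measurableSet_Ioi fun s hs => ?_
  have hs : (0 : ℝ) < s := hs
  rw [arrivalWeight, if_neg hq.ne', max_eq_left hs.le]
  refine mul_le_of_le_one_right zero_le ?_
  rw [← ENNReal.ofReal_one]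
  exact ENNReal.ofReal_le_ofReal (Real.exp_le_one_iff.2 (by linarith))

/-- Jensen's inequality for the concave `log (1 + s / q)`: given that `y` wins, `ω y` has mean `p x
y`. -/
theorem setLIntegral_winner_log_le [Countable 𝒴] (p : 𝒳 → PMF 𝒴) (x : 𝒳) (y : 𝒴) {q : ℝ}
    (hq : 0 < q) :
    ∫⁻ ω in winner p x y, ENNReal.ofReal (Real.log (1 + max (ω y) 0 / q)) ∂clocks 𝒴
      ≤ p x y * ENNReal.ofReal (Real.log (1 + (p x y).toReal / q)) := by
  by_cases h : p x y = 0
  · simp [winner_of_eq_zero h]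
  have hp := ENNReal.toReal_pos h ((p x).apply_ne_top y)
  set a := (p x y).toReal with ha
  have hr : 0 < 1 + a / q := by positivity
  -- Intercept and slope of the tangent line to `log (1 + s / q)` at `s = a`.
  have hA : 0 ≤ Real.log (1 + a / q) - (a / q) / (1 + a / q) := by
    have := Real.one_sub_inv_le_log_of_pos hr
    have h2 : (a / q) / (1 + a / q) = 1 - (1 + a / q)⁻¹ := by field_simp; ring
    linarith
  have hB : 0 ≤ 1 / (q * (1 + a / q)) := by positivity
  have hle := setLIntegral_winSet_le (c := fun i => (p x i).toReal / a) (y := y)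
    (fun i => by positivity) (div_self hp.ne') ((hasSum_toReal (p x)).div_const a) hA hB
  rw [winner_of_ne_zero h]
  refine (lintegral_mono fun ω => ?_).trans (hle.trans_eq ?_)
  · rcases le_total (ω y) 0 with hω | hω
    · simp [max_eq_right hω]
    · rw [max_eq_left hω]
      refine ENNReal.ofReal_le_ofReal ?_
      have hz : 0 < 1 + ω y / q := by positivity
      have := Real.log_le_sub_one_of_pos (div_pos hz hr)
      rw [Real.log_div hz.ne' hr.ne'] at this
      have h3 : (1 + ω y / q) / (1 + a / q) - 1
          = 1 / (q * (1 + a / q)) * ω y - (a / q) / (1 + a / q) := by field_simp; ring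
      linarith
  · conv_rhs => enter [1]; rw [← ENNReal.ofReal_toReal ((p x).apply_ne_top y)]
    rw [← ENNReal.ofReal_mul ENNReal.toReal_nonneg]
    congr 1
    rw [← ha]
    field_simp
    ring

variable [Finite 𝒳] [Countable 𝒴]

/-- For each outcome of the clocks, Gibbs' inequality compares the law of `u(X)` with the weights at
the arrival times `ω y / q y`. The cost of a symbol is `log M + (1 + M⁻¹) * log (1 + ω y / q y)`,
and averaging over the race turns `ω y` into `p x y`. -/
theorem raceLaw_entropy_le (p : 𝒳 → PMF 𝒴) (q : PMF 𝒴) (hpq : ∀ x y, q y = 0 → p x y = 0)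
    (π : PMF 𝒳) {M : ℝ} (hM : 1 ≤ M) :
    ∑' u, raceLaw p u * ∑' x, π x * ENNReal.ofReal (-Real.log (π.map u (u x)).toReal)
      ≤ ENNReal.ofReal (Real.log M) + ENNReal.ofReal (1 + M⁻¹) *
        ∑' x, π x * ∑' y, p x y * ENNReal.ofReal (Real.log (1 + (p x y).toReal / (q y).toReal)) := by
  have hM0 : 0 < M := one_pos.trans_le hM
  let w : 𝒴 → (𝒴 → ℝ) → ℝ := fun y ω => arrivalWeight M (q y).toReal (ω y)
  have hwm : ∀ y, Measurable (w y) := fun y =>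
    (measurable_arrivalWeight _ _).comp (measurable_pi_apply y)
  have hw0 : ∀ x y ω, ω ∈ winner p x y → 0 < w y ω := fun x y ω h =>
    arrivalWeight_pos hM0 (ENNReal.toReal_pos (fun h0 => h.1 (hpq x y h0)) (q.apply_ne_top y)) _
  set G : (𝒳 → 𝒴) → ℝ≥0∞ :=
    fun u => ∑' x, π x * ENNReal.ofReal (-Real.log (π.map u (u x)).toReal) with hG
  have hpt : ∀ u, raceLaw p u * (G u + 1)
      ≤ ∑' x, π x * ∫⁻ ω in winners p u, ENNReal.ofReal (-Real.log (w (u x) ω)) ∂clocks 𝒴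
        + ∫⁻ ω in winners p u, ∑' y, ENNReal.ofReal (w y ω) ∂clocks 𝒴 := by
    intro u
    have hm : ∀ x, Measurable fun ω => ENNReal.ofReal (-Real.log (w (u x) ω)) :=
      fun x => (hwm _).log.neg.ennreal_ofReal
    simp_rw [← fun x => lintegral_const_mul' (μ := (clocks 𝒴).restrict (winners p u)) (π x)
      (fun ω => ENNReal.ofReal (-Real.log (w (u x) ω))) (π.apply_ne_top x)]
    rw [← lintegral_tsum fun x => ((hm x).const_mul _).aemeasurable,
      ← lintegral_add_right _ (Measurable.tsum fun y => (hwm y).ennreal_ofReal),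
      raceLaw_apply, mul_comm, ← setLIntegral_const]
    refine setLIntegral_mono' (measurableSet_winners p u) fun ω hω => ?_
    exact gibbs_map π u (fun y => w y ω) fun x => hw0 x _ ω (mem_iInter.1 hω x)
  have hsum := ENNReal.tsum_le_tsum hpt
  simp only [mul_add, mul_one, ENNReal.tsum_add, PMF.tsum_coe] at hsum
  rw [ENNReal.tsum_comm] at hsum
  simp only [ENNReal.tsum_mul_left] at hsum
  simp_rw [fun x => tsum_setLIntegral_winners p x fun y ω => ENNReal.ofReal (-Real.log (w y ω))]
    at hsum
  have htot := tsum_setLIntegral_winners_inter p MeasurableSet.univ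
    fun ω => ∑' y, ENNReal.ofReal (w y ω)
  simp only [inter_univ, Measure.restrict_univ] at htot
  have hle1 : ∫⁻ ω, ∑' y, ENNReal.ofReal (w y ω) ∂clocks 𝒴 ≤ 1 := by
    rw [lintegral_tsum fun y => (hwm y).ennreal_ofReal.aemeasurable, ← PMF.tsum_coe q]
    refine ENNReal.tsum_le_tsum fun y => ?_
    refine (lintegral_arrivalWeight_le hM0 ENNReal.toReal_nonneg 𝒴 y).trans_eq ?_
    exact ENNReal.ofReal_toReal (q.apply_ne_top y)
  rw [htot] at hsum
  -- The expected total weight, at most one, cancels against the `1` from Gibbs' inequality.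
  have hsum' := (ENNReal.add_le_add_iff_right ENNReal.one_ne_top).1
    (hsum.trans (add_le_add_right hle1 _))
  refine hsum'.trans ?_
  have hxy : ∀ x y, ∫⁻ ω in winner p x y, ENNReal.ofReal (-Real.log (w y ω)) ∂clocks 𝒴
      ≤ p x y * ENNReal.ofReal (Real.log M) + ENNReal.ofReal (1 + M⁻¹) *
        (p x y * ENNReal.ofReal (Real.log (1 + (p x y).toReal / (q y).toReal))) := by
    intro x y
    by_cases h : p x y = 0
    · simp [winner_of_eq_zero h]
    have hq : 0 < (q y).toReal := ENNReal.toReal_pos (fun h0 => h (hpq x y h0)) (q.apply_ne_top y)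
    have heq : ∀ ω, ENNReal.ofReal (-Real.log (w y ω)) = ENNReal.ofReal (Real.log M)
        + ENNReal.ofReal (1 + M⁻¹) * ENNReal.ofReal (Real.log (1 + max (ω y) 0 / (q y).toReal)) := by
      intro ω
      have : 0 ≤ max (ω y) 0 / (q y).toReal := div_nonneg (le_max_right _ _) hq.le
      have hl : 0 ≤ Real.log (1 + max (ω y) 0 / (q y).toReal) := Real.log_nonneg (by linarith)
      rw [← ENNReal.ofReal_mul (by positivity),
        ← ENNReal.ofReal_add (Real.log_nonneg hM) (by positivity), neg_log_arrivalWeight hM0 hq]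
    simp_rw [heq]
    rw [lintegral_add_left measurable_const, setLIntegral_const, clocks_winner,
      lintegral_const_mul' _ _ ENNReal.ofReal_ne_top, mul_comm (p x y)]
    gcongr
    exact setLIntegral_winner_log_le p x y hq
  calc _ ≤ ∑' x, π x * ∑' y, (p x y * ENNReal.ofReal (Real.log M) + ENNReal.ofReal (1 + M⁻¹) *
        (p x y * ENNReal.ofReal (Real.log (1 + (p x y).toReal / (q y).toReal)))) :=
        ENNReal.tsum_le_tsum fun x => mul_le_mul_right (ENNReal.tsum_le_tsum fun y => hxy x y) _
    _ = _ := by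
        simp only [ENNReal.tsum_add, ENNReal.tsum_mul_right, ENNReal.tsum_mul_left, PMF.tsum_coe,
          mul_add, one_mul]
        congr 1
        rw [← ENNReal.tsum_mul_left]
        exact tsum_congr fun x => by ring

end RaceEntropy

/-! ### Time sharing of two disclosure kernels -/

section TimeSharing

variable {Z V V₀ V₁ γ : Type*}

/-- Joint law of `(Z, V)` when `V` is generated from `Z` by a kernel with any alphabet. -/
noncomputable def kernelLaw (P : PMF Z) (κ : Z → PMF V) : PMF (Z × V) :=
  P.bind fun z => (κ z).map fun v => (z, v)

theorem kernelLaw_apply (P : PMF Z) (κ : Z → PMF V) (z : Z) (v : V) :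
    kernelLaw P κ (z, v) = P z * κ z v := by
  rw [kernelLaw, PMF.bind_apply, tsum_eq_single z]
  · rw [map_apply_injective (κ z) (f := fun v => (z, v)) fun a b h => by simpa using h]
  · intro z' hz
    rw [map_apply_eq_zero, mul_zero]
    rintro ⟨v', hv'⟩
    exact hz (Prod.ext_iff.1 hv').1

/-- Joint law of `(f Z, V)` when `V` is generated from `Z` by a kernel. -/
noncomputable def kernelLawMap (f : Z → γ) (P : PMF Z) (κ : Z → PMF V) : PMF (γ × V) :=
  (kernelLaw P κ).map fun w => (f w.1, w.2)

open Classical in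
theorem kernelLawMap_apply (f : Z → γ) (P : PMF Z) (κ : Z → PMF V) (c : γ) (v : V) :
    kernelLawMap f P κ (c, v) = ∑' z, if c = f z then P z * κ z v else 0 := by
  rw [kernelLawMap, PMF.map_apply, ENNReal.tsum_prod']
  refine tsum_congr fun z => ?_
  rw [tsum_eq_single v]
  · simp [kernelLaw_apply]
  · intro v' hv
    simp [hv.symm]

theorem kernelLawMap_fst (f : Z → γ) (P : PMF Z) (κ : Z → PMF V) :
    (kernelLawMap f P κ).map Prod.fst = P.map f := by
  rw [kernelLawMap, kernelLaw, PMF.map_comp, PMF.map_bind]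
  simp only [PMF.map_comp]
  change (P.bind fun z => (κ z).map (Function.const V (f z))) = P.map f
  simp only [PMF.map_const]
  rfl

theorem kernelLawMap_map (f : Z → γ) (P : PMF Z) (κ : Z → PMF V) {W : Type*} (e : V → W) :
    kernelLawMap f P (fun z => (κ z).map e) = (kernelLawMap f P κ).map (Prod.map id e) := by
  simp only [kernelLawMap, kernelLaw, PMF.map_comp, PMF.map_bind]
  rfl

theorem mutualInfo_map_injective {α β W : Type*} [Countable α] [Countable β] [Countable W]
    (J : PMF (α × β)) {e : β → W} (he : Function.Injective e) :
    mutualInfo (J.map (Prod.map id e)) = mutualInfo J := by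
  have hi : Function.Injective (Prod.map (id : α → α) e) := Function.injective_id.prodMap he
  have h1 : (J.map (Prod.map id e)).map Prod.fst = J.map Prod.fst := by
    rw [PMF.map_comp]; rfl
  have h2 : (J.map (Prod.map id e)).map Prod.snd = (J.map Prod.snd).map e := by
    rw [PMF.map_comp, PMF.map_comp]; rfl
  rw [← ENNReal.mul_left_inj ln2_ne_zero ln2_ne_top, mutualInfo_mul_ln2, mutualInfo_mul_ln2,
    h1, h2, ← hi.tsum_eq]
  · refine tsum_congr fun z => ?_
    rw [map_apply_injective J hi]
    congr 2
    exact map_apply_injective _ he z.2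
  · intro z hz
    by_contra hr
    refine hz ?_
    beta_reduce
    rw [map_apply_eq_zero J _ hr, map_apply_eq_zero (J.map Prod.snd) e (b := z.2), mul_zero,
      klTerm_zero_left 0 ENNReal.zero_ne_top]
    rintro ⟨b, hb⟩
    exact hr ⟨(z.1, b), Prod.ext rfl hb⟩

theorem tsum_sumType (f : V₀ ⊕ V₁ → ℝ≥0∞) :
    ∑' v, f v = ∑' v, f (Sum.inl v) + ∑' v, f (Sum.inr v) :=
  (HasSum.sum ENNReal.summable.hasSum ENNReal.summable.hasSum).tsum_eq

/-- Time sharing of two laws, revealing which one is used: the second one has weight `t`. -/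
noncomputable def timeShare (t : ℝ≥0∞) (ht : t ≤ 1) (p₀ : PMF V₀) (p₁ : PMF V₁) : PMF (V₀ ⊕ V₁) :=
  ⟨Sum.elim (fun v => (1 - t) * p₀ v) (fun v => t * p₁ v), by
    rw [ENNReal.summable.hasSum_iff, tsum_sumType]
    simp [ENNReal.tsum_mul_left, PMF.tsum_coe, tsub_add_cancel_of_le ht]⟩

/-- Since the disjoint union reveals which kernel is used, the joint law on each component is a
scaled copy of one law, and `klTerm` is homogeneous of degree one. -/
theorem mutualInfo_timeShare [Countable V₀] [Countable V₁] [Countable γ] (f : Z → γ) (P : PMF Z)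
    (t : ℝ≥0∞) (ht : t ≤ 1) (κ₀ : Z → PMF V₀) (κ₁ : Z → PMF V₁) :
    mutualInfo (kernelLawMap f P fun z => timeShare t ht (κ₀ z) (κ₁ z))
      = (1 - t) * mutualInfo (kernelLawMap f P κ₀) + t * mutualInfo (kernelLawMap f P κ₁) := by
  classical
  set J := kernelLawMap f P fun z => timeShare t ht (κ₀ z) (κ₁ z) with hJ
  have h0 : ∀ c v, J (c, Sum.inl v) = (1 - t) * kernelLawMap f P κ₀ (c, v) := by
    intro c v
    rw [hJ, kernelLawMap_apply, kernelLawMap_apply, ← ENNReal.tsum_mul_left]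
    refine tsum_congr fun z => ?_
    rw [mul_ite, mul_zero]
    refine if_congr Iff.rfl ?_ rfl
    change P z * ((1 - t) * κ₀ z v) = _
    ring
  have h1 : ∀ c v, J (c, Sum.inr v) = t * kernelLawMap f P κ₁ (c, v) := by
    intro c v
    rw [hJ, kernelLawMap_apply, kernelLawMap_apply, ← ENNReal.tsum_mul_left]
    refine tsum_congr fun z => ?_
    rw [mul_ite, mul_zero]
    refine if_congr Iff.rfl ?_ rfl
    change P z * (t * κ₁ z v) = _
    ring
  have s0 : ∀ v, J.map Prod.snd (Sum.inl v)
      = (1 - t) * (kernelLawMap f P κ₀).map Prod.snd v := by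
    intro v
    simp_rw [map_snd_apply, h0, ENNReal.tsum_mul_left]
  have s1 : ∀ v, J.map Prod.snd (Sum.inr v) = t * (kernelLawMap f P κ₁).map Prod.snd v := by
    intro v
    simp_rw [map_snd_apply, h1, ENNReal.tsum_mul_left]
  have ht' : t ≠ ∞ := (ht.trans_lt ENNReal.one_lt_top).ne
  have ht1 : 1 - t ≠ ∞ := ENNReal.sub_ne_top ENNReal.one_ne_top
  rw [← ENNReal.mul_left_inj ln2_ne_zero ln2_ne_top, add_mul, mul_assoc, mul_assoc,
    mutualInfo_mul_ln2, mutualInfo_mul_ln2, mutualInfo_mul_ln2]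
  simp_rw [kernelLawMap_fst, hJ, kernelLawMap_fst, ← hJ]
  rw [ENNReal.tsum_prod', ENNReal.tsum_prod', ENNReal.tsum_prod', ← ENNReal.tsum_mul_left,
    ← ENNReal.tsum_mul_left, ← ENNReal.tsum_add]
  refine tsum_congr fun c => ?_
  rw [tsum_sumType, ← ENNReal.tsum_mul_left, ← ENNReal.tsum_mul_left]
  congr 1
  · refine tsum_congr fun v => ?_
    simp only
    rw [h0, s0, mul_left_comm, klTerm_mul _ _ _ ht1]
  · refine tsum_congr fun v => ?_
    simp only
    rw [h1, s1, mul_left_comm, klTerm_mul _ _ _ ht']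

theorem exists_timeShare {𝒳 𝒴 : Type*} [Countable 𝒳] [Countable 𝒴] [Countable V₀] [Countable V₁]
    (P : PMF (𝒳 × 𝒴)) (t : ℝ≥0∞) (ht : t ≤ 1) (κ₀ : 𝒳 × 𝒴 → PMF V₀) (κ₁ : 𝒳 × 𝒴 → PMF V₁) :
    ∃ κ : 𝒳 × 𝒴 → PMF ℕ,
      mutualInfo (lawXU P κ) = (1 - t) * mutualInfo (kernelLawMap Prod.fst P κ₀)
        + t * mutualInfo (kernelLawMap Prod.fst P κ₁) ∧
      mutualInfo (lawYU P κ) = (1 - t) * mutualInfo (kernelLawMap Prod.snd P κ₀)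
        + t * mutualInfo (kernelLawMap Prod.snd P κ₁) := by
  obtain ⟨e, he⟩ := exists_injective_nat (V₀ ⊕ V₁)
  refine ⟨fun z => (timeShare t ht (κ₀ z) (κ₁ z)).map e, ?_, ?_⟩
  · change mutualInfo (kernelLawMap Prod.fst P _) = _
    rw [kernelLawMap_map, mutualInfo_map_injective _ he, mutualInfo_timeShare]
  · change mutualInfo (kernelLawMap Prod.snd P _) = _
    rw [kernelLawMap_map, mutualInfo_map_injective _ he, mutualInfo_timeShare]

theorem kernelLawMap_pure (f : Z → γ) (g : Z → V) (P : PMF Z) :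
    kernelLawMap f P (fun z => PMF.pure (g z)) = P.map fun z => (f z, g z) := by
  simp only [kernelLawMap, kernelLaw, PMF.pure_map, PMF.map_bind]
  rfl

/-- Disclosing `Y` itself. -/
theorem mutualInfo_kernelLawMap_pure_snd {𝒳 𝒴 : Type*} [Countable 𝒳] [Countable 𝒴]
    (P : PMF (𝒳 × 𝒴)) :
    mutualInfo (kernelLawMap Prod.fst P fun z => PMF.pure z.2) = mutualInfo P ∧
    mutualInfo (kernelLawMap Prod.snd P fun z => PMF.pure z.2) = HY P := by
  constructor
  · rw [kernelLawMap_pure]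
    congr 1
    exact PMF.map_id P
  · rw [kernelLawMap_pure]
    have h0 : condEntropy (P.map fun z : 𝒳 × 𝒴 => (z.2, z.2)) = 0 := by
      rw [← ENNReal.mul_left_inj ln2_ne_zero ln2_ne_top, condEntropy_mul_ln2, zero_mul,
        tsum_map_mul, ENNReal.tsum_eq_zero]
      intro z
      have e1 : (P.map fun z : 𝒳 × 𝒴 => (z.2, z.2)) (z.2, z.2) = P.map Prod.snd z.2 := by
        have : (P.map fun z : 𝒳 × 𝒴 => (z.2, z.2)) = (P.map Prod.snd).map fun y => (y, y) := by
          rw [PMF.map_comp]; rfl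
        rw [this]
        exact map_apply_injective _ (f := fun y : 𝒴 => (y, y)) (fun a b h => (Prod.ext_iff.1 h).1) _
      have e2 : (P.map fun z : 𝒳 × 𝒴 => (z.2, z.2)).map Prod.fst = P.map Prod.snd := by
        rw [PMF.map_comp]; rfl
      rw [e1, e2]
      simp
    have := mutualInfo_add_condEntropy (P.map fun z : 𝒳 × 𝒴 => (z.2, z.2))
    rw [h0, add_zero, PMF.map_comp] at this
    exact this

end TimeSharing

/-! ### The race as a functional representation of `Y` -/

section FunctionalRepresentation

variable {𝒳 𝒴 : Type*}

theorem mutualInfo_add_HYgivenX [Countable 𝒳] [Countable 𝒴] (P : PMF (𝒳 × 𝒴)) :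
    mutualInfo P + HYgivenX P = HY P := mutualInfo_add_condEntropy P

theorem mutualInfo_add_HXgivenY [Countable 𝒳] [Countable 𝒴] (P : PMF (𝒳 × 𝒴)) :
    mutualInfo P + HXgivenY P = HX P := by
  have := mutualInfo_add_condEntropy (P.map Prod.swap)
  rwa [mutualInfo_swap, map_snd_swap] at this

theorem HX_ne_top [Finite 𝒳] (P : PMF (𝒳 × 𝒴)) : HX P ≠ ∞ := entropy_ne_top _

theorem HXgivenY_ne_top [Finite 𝒳] [Countable 𝒴] (P : PMF (𝒳 × 𝒴)) : HXgivenY P ≠ ∞ :=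
  ne_top_of_le_ne_top (HX_ne_top P) (mutualInfo_add_HXgivenY P ▸ le_add_self)

theorem mutualInfo_ne_top [Finite 𝒳] [Countable 𝒴] (P : PMF (𝒳 × 𝒴)) : mutualInfo P ≠ ∞ :=
  ne_top_of_le_ne_top (HX_ne_top P) (mutualInfo_add_HXgivenY P ▸ le_self_add)

/-- `H(X | Y) = 0` exactly when every atom carries the whole mass of its second coordinate. -/
theorem HXgivenY_eq_zero_iff (P : PMF (𝒳 × 𝒴)) :
    HXgivenY P = 0 ↔ ∀ z, P z ≠ 0 → P.map Prod.snd z.2 = P z := by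
  rw [← ENNReal.mul_left_inj ln2_ne_zero ln2_ne_top, zero_mul, HXgivenY, condEntropy_mul_ln2,
    tsum_map_mul, ENNReal.tsum_eq_zero, map_fst_swap]
  refine forall_congr' fun z => ?_
  have hle : P z ≤ P.map Prod.snd z.2 := apply_le_map P Prod.snd z
  have ht : P.map Prod.snd z.2 ≠ ∞ := PMF.apply_ne_top _ _
  rw [mul_eq_zero, or_iff_not_imp_left, map_apply_injective P Prod.swap_injective z]
  refine imp_congr_right fun h0 => ?_
  have hpos := ENNReal.toReal_pos h0 (P.apply_ne_top z)
  rw [ENNReal.ofReal_eq_zero, Prod.fst_swap,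
    Real.log_nonpos_iff (div_nonneg ENNReal.toReal_nonneg ENNReal.toReal_nonneg),
    div_le_one hpos, ENNReal.toReal_le_toReal ht (P.apply_ne_top z)]
  exact ⟨fun h => le_antisymm h hle, fun h => h.le⟩

theorem map_snd_eq_of_unique {P : PMF (𝒳 × 𝒴)} {z : 𝒳 × 𝒴}
    (h : ∀ x, P (x, z.2) ≠ 0 → x = z.1) : P.map Prod.snd z.2 = P z := by
  rw [map_snd_apply, tsum_eq_single z.1]
  intro x hx
  by_contra h0
  exact hx (h x h0)

theorem add_le_map_snd (P : PMF (𝒳 × 𝒴)) {x x' : 𝒳} (hx : x ≠ x') (y : 𝒴) :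
    P (x, y) + P (x', y) ≤ P.map Prod.snd y := by
  classical
  rw [map_snd_apply, ← Finset.sum_pair hx (f := fun x => P (x, y))]
  exact ENNReal.sum_le_tsum _

theorem HXgivenY_eq_zero_iff_exists (P : PMF (𝒳 × 𝒴)) :
    HXgivenY P = 0 ↔ ∃ f : 𝒴 → 𝒳, ∀ z ∈ P.support, z.1 = f z.2 := by
  rw [HXgivenY_eq_zero_iff]
  constructor
  · intro h
    obtain ⟨z₀, -⟩ := P.support_nonempty
    have : ∀ y, ∃ x, ∀ x', P (x', y) ≠ 0 → x' = x := by
      intro y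
      by_cases hy : ∃ x, P (x, y) ≠ 0
      · obtain ⟨x, hx⟩ := hy
        refine ⟨x, fun x' hx' => ?_⟩
        by_contra hne
        have := add_le_map_snd P (Ne.symm hne) y
        rw [h (x, y) hx] at this
        exact hx' (nonpos_iff_eq_zero.1
          ((ENNReal.add_le_add_iff_left (P.apply_ne_top (x, y))).1 (by simpa using this)))
      · push Not at hy
        exact ⟨z₀.1, fun x' hx' => absurd (hy x') hx'⟩
    choose f hf using this
    exact ⟨f, fun z hz => hf z.2 z.1 hz⟩
  · rintro ⟨f, hf⟩ z hz
    exact map_snd_eq_of_unique fun x hx => (hf (x, z.2) hx).trans (hf z hz).symm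

theorem exists_of_HXgivenY_ne_zero {P : PMF (𝒳 × 𝒴)} (h : HXgivenY P ≠ 0) :
    ∃ x x' y, x ≠ x' ∧ P (x, y) ≠ 0 ∧ P (x', y) ≠ 0 := by
  rw [Ne, HXgivenY_eq_zero_iff] at h
  push Not at h
  obtain ⟨z, hz, hne⟩ := h
  by_contra! hcon
  refine hne (map_snd_eq_of_unique fun x hx => ?_)
  by_contra hxz
  exact hx (hcon z.1 x z.2 (Ne.symm hxz) hz)

/-- The distribution with a given mass function. -/
noncomputable def pmfOfTsum {α : Type*} (f : α → ℝ≥0∞) (h : ∑' a, f a = 1) : PMF α :=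
  ⟨f, ENNReal.summable.hasSum_iff.2 h⟩

theorem pmfOfTsum_apply {α : Type*} (f : α → ℝ≥0∞) (h : ∑' a, f a = 1) (a : α) :
    pmfOfTsum f h a = f a := rfl

open Classical in
/-- Conditional law of `Y` given `X = x` (the law of `Y` if `x` has probability zero). -/
noncomputable def condLaw (P : PMF (𝒳 × 𝒴)) (x : 𝒳) : PMF 𝒴 :=
  if h : P.map Prod.fst x = 0 then P.map Prod.snd
  else pmfOfTsum (fun y => P (x, y) / P.map Prod.fst x) <| by
    simp_rw [div_eq_mul_inv]
    rw [ENNReal.tsum_mul_right, ← map_fst_apply, ENNReal.mul_inv_cancel h (PMF.apply_ne_top _ _)]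

theorem map_fst_mul_condLaw (P : PMF (𝒳 × 𝒴)) (x : 𝒳) (y : 𝒴) :
    P.map Prod.fst x * condLaw P x y = P (x, y) := by
  have hle : P (x, y) ≤ P.map Prod.fst x := apply_le_map P Prod.fst (x, y)
  by_cases h : P.map Prod.fst x = 0
  · rw [h, zero_mul]
    exact (le_antisymm (hle.trans h.le) bot_le).symm
  · rw [condLaw, dif_neg h, pmfOfTsum_apply]
    exact ENNReal.mul_div_cancel h (PMF.apply_ne_top _ _)

theorem condLaw_eq_zero (P : PMF (𝒳 × 𝒴)) (x : 𝒳) {y : 𝒴} (hy : P.map Prod.snd y = 0) :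
    condLaw P x y = 0 := by
  have hle : P (x, y) ≤ P.map Prod.snd y := apply_le_map P Prod.snd (x, y)
  rw [condLaw]
  split_ifs with h
  · exact hy
  · rw [pmfOfTsum_apply]
    rw [hy, nonpos_iff_eq_zero] at hle
    rw [hle, ENNReal.zero_div]

theorem condLaw_ne_zero {P : PMF (𝒳 × 𝒴)} {x : 𝒳} {y : 𝒴} (h : P (x, y) ≠ 0) :
    condLaw P x y ≠ 0 := by
  rw [← map_fst_mul_condLaw] at h
  exact right_ne_zero_of_mul h

/-- With `r = P(y|x) / P(y)`, one has `log (1 + r) = log r + log (1 + 1/r) ≤ log r + 1/r`. The first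
term averages to the mutual information in nats, the second to at most one. -/
theorem tsum_condLaw_log_le [Countable 𝒳] [Countable 𝒴] (P : PMF (𝒳 × 𝒴)) :
    ∑' x, P.map Prod.fst x * ∑' y, condLaw P x y *
        ENNReal.ofReal (Real.log (1 + (condLaw P x y).toReal / (P.map Prod.snd y).toReal))
      ≤ mutualInfo P * ln2 + 1 := by
  rw [mutualInfo_mul_ln2, ← PMF.tsum_coe P, ← ENNReal.tsum_add, ENNReal.tsum_prod']
  simp_rw [← ENNReal.tsum_mul_left]
  refine ENNReal.tsum_le_tsum fun x => ENNReal.tsum_le_tsum fun y => ?_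
  rw [← mul_assoc, map_fst_mul_condLaw]
  by_cases h0 : P (x, y) = 0
  · simp [h0]
  have hpos := ENNReal.toReal_pos h0 (P.apply_ne_top (x, y))
  have hx : 0 < (P.map Prod.fst x).toReal := hpos.trans_le
    (ENNReal.toReal_mono (PMF.apply_ne_top _ _) (apply_le_map P Prod.fst (x, y)))
  have hy : 0 < (P.map Prod.snd y).toReal := hpos.trans_le
    (ENNReal.toReal_mono (PMF.apply_ne_top _ _) (apply_le_map P Prod.snd (x, y)))
  have hmul := congrArg ENNReal.toReal (map_fst_mul_condLaw P x y)
  rw [ENNReal.toReal_mul] at hmul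
  have hr : (condLaw P x y).toReal / (P.map Prod.snd y).toReal
      = (P (x, y)).toReal / ((P.map Prod.fst x).toReal * (P.map Prod.snd y).toReal) := by
    rw [← hmul]; field_simp
  rw [hr, klTerm, ENNReal.toReal_mul]
  set a := (P (x, y)).toReal with ha
  set b := (P.map Prod.fst x).toReal * (P.map Prod.snd y).toReal with hb
  have hbpos : 0 < b := mul_pos hx hy
  have e : P (x, y) = ENNReal.ofReal a := (ENNReal.ofReal_toReal (P.apply_ne_top _)).symm
  rw [e, ← ENNReal.ofReal_mul hpos.le,
    ← ENNReal.ofReal_add (klTerm_arg_nonneg hpos.le hbpos.le fun h => absurd h hbpos.ne') hpos.le]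
  refine ENNReal.ofReal_le_ofReal ?_
  have h1 : 1 + a / b = a / b * (1 + b / a) := by field_simp; ring
  have h2 : Real.log (1 + b / a) ≤ b / a := by
    have := Real.log_le_sub_one_of_pos (x := 1 + b / a) (by positivity)
    linarith
  rw [h1, Real.log_mul (by positivity) (by positivity)]
  have h3 := mul_le_mul_of_nonneg_left h2 hpos.le
  have h4 : a * (b / a) = b := by field_simp
  linarith

theorem raceEntropy_term_le (P : PMF (𝒳 × 𝒴)) (u : 𝒳 → 𝒴) (x : 𝒳) :
    P.map Prod.fst x * ENNReal.ofReal (-Real.log ((P.map Prod.fst).map u (u x)).toReal)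
      ≤ P.map Prod.fst x * ENNReal.ofReal (-Real.log (P.map Prod.fst x).toReal) := by
  by_cases h : P.map Prod.fst x = 0
  · rw [h, zero_mul, zero_mul]
  have hpos := ENNReal.toReal_pos h (PMF.apply_ne_top _ _)
  gcongr
  · exact PMF.apply_ne_top _ _
  · exact apply_le_map _ u x

section Kernel

variable [Finite 𝒳] [Countable 𝒴]

open Classical in
/-- The race conditioned on input `x` selecting `y`. -/
noncomputable def raceKernel (P : PMF (𝒳 × 𝒴)) (z : 𝒳 × 𝒴) : PMF (𝒳 → 𝒴) :=
  if h : condLaw P z.1 z.2 = 0 then raceLaw (condLaw P)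
  else pmfOfTsum
      (fun u => raceLaw (condLaw P) u * (if u z.1 = z.2 then 1 else 0) / condLaw P z.1 z.2) <| by
    simp_rw [div_eq_mul_inv]
    rw [ENNReal.tsum_mul_right,
      tsum_raceLaw_mul (condLaw P) z.1 (fun y => if y = z.2 then 1 else 0),
      tsum_eq_single z.2 (fun y hy => by simp [hy])]
    simp [ENNReal.mul_inv_cancel h (PMF.apply_ne_top _ _)]

open Classical in
-- Bayes' rule: under the coupled law, `X` and `U` are independent and `Y = U(X)`.
theorem mul_raceKernel (P : PMF (𝒳 × 𝒴)) (x : 𝒳) (y : 𝒴) (u : 𝒳 → 𝒴) :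
    P (x, y) * raceKernel P (x, y) u
      = P.map Prod.fst x * (raceLaw (condLaw P) u * if u x = y then 1 else 0) := by
  rw [← map_fst_mul_condLaw, mul_assoc]
  congr 1
  by_cases h : condLaw P x y = 0
  · rw [h, zero_mul]
    -- The race gives the event `u x = y` probability `condLaw P x y = 0`, so each of its terms
    -- vanishes.
    have := tsum_raceLaw_mul (condLaw P) x (fun y' => if y' = y then 1 else 0)
    rw [tsum_eq_single (f := fun y' => condLaw P x y' * _) y (fun y' hy => by simp [hy]), h,
      zero_mul, ENNReal.tsum_eq_zero] at this
    exact (this u).symm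
  · rw [raceKernel, dif_neg h, pmfOfTsum_apply]
    exact ENNReal.mul_div_cancel h (PMF.apply_ne_top _ _)

theorem raceKernel_independent (P : PMF (𝒳 × 𝒴)) :
    mutualInfo (kernelLawMap Prod.fst P (raceKernel P)) = 0 := by
  classical
  refine mutualInfo_eq_zero_of_indep (p := P.map Prod.fst) (q := raceLaw (condLaw P)) ?_
  rintro ⟨x, u⟩
  rw [kernelLawMap_apply, ENNReal.tsum_prod', tsum_eq_single x]
  · simp only [if_true, mul_raceKernel]
    rw [ENNReal.tsum_mul_left, tsum_eq_single (u x) (fun y hy => by simp [hy.symm])]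
    simp
  · intro x' hx
    simp [hx.symm]

theorem kernelLawMap_snd_raceKernel (P : PMF (𝒳 × 𝒴)) (y : 𝒴) (u : 𝒳 → 𝒴) :
    kernelLawMap Prod.snd P (raceKernel P) (y, u)
      = raceLaw (condLaw P) u * (P.map Prod.fst).map u y := by
  classical
  rw [kernelLawMap_apply, ENNReal.tsum_prod', PMF.map_apply, ← ENNReal.tsum_mul_left]
  refine tsum_congr fun x => ?_
  rw [tsum_eq_single y (fun y' hy => by simp [hy.symm])]
  simp only [if_true, mul_raceKernel]
  by_cases h : u x = y
  · simp [h, mul_comm]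
  · simp [h, Ne.symm h]

/-- `H(Y | U)` for the kernel given by the race. -/
noncomputable def raceEntropy (P : PMF (𝒳 × 𝒴)) : ℝ≥0∞ :=
  condEntropy ((kernelLawMap Prod.snd P (raceKernel P)).map Prod.swap)

theorem mutualInfo_add_raceEntropy (P : PMF (𝒳 × 𝒴)) :
    mutualInfo (kernelLawMap Prod.snd P (raceKernel P)) + raceEntropy P = HY P := by
  have := mutualInfo_add_condEntropy ((kernelLawMap Prod.snd P (raceKernel P)).map Prod.swap)
  rwa [mutualInfo_swap, map_snd_swap, kernelLawMap_fst] at this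

theorem raceEntropy_mul_ln2 (P : PMF (𝒳 × 𝒴)) :
    raceEntropy P * ln2 = ∑' u, raceLaw (condLaw P) u * ∑' x, P.map Prod.fst x *
      ENNReal.ofReal (-Real.log ((P.map Prod.fst).map u (u x)).toReal) := by
  have hsnd : (kernelLawMap Prod.snd P (raceKernel P)).map Prod.snd = raceLaw (condLaw P) :=
    PMF.ext fun u => by
      simp_rw [map_snd_apply, kernelLawMap_snd_raceKernel, ENNReal.tsum_mul_left, PMF.tsum_coe,
        mul_one]
  rw [raceEntropy, condEntropy_mul_ln2, tsum_map_mul, map_fst_swap, hsnd, ENNReal.tsum_prod',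
    ENNReal.tsum_comm]
  refine tsum_congr fun u => ?_
  rw [← tsum_map_mul (P.map Prod.fst) u
    (fun y => ENNReal.ofReal (-Real.log ((P.map Prod.fst).map u y).toReal)),
    ← ENNReal.tsum_mul_left]
  refine tsum_congr fun y => ?_
  rw [map_apply_injective _ Prod.swap_injective, kernelLawMap_snd_raceKernel, mul_assoc]
  by_cases h : raceLaw (condLaw P) u = 0
  · simp [h]
  have hpos := ENNReal.toReal_pos h (PMF.apply_ne_top _ _)
  congr 4
  rw [ENNReal.toReal_mul, Prod.fst_swap, ← div_div, div_self hpos.ne', one_div, Real.log_inv]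

theorem HX_mul_ln2 (P : PMF (𝒳 × 𝒴)) : HX P * ln2 = ∑' u, raceLaw (condLaw P) u *
    ∑' x, P.map Prod.fst x * ENNReal.ofReal (-Real.log (P.map Prod.fst x).toReal) := by
  rw [ENNReal.tsum_mul_right, PMF.tsum_coe, one_mul, HX, entropy_mul_ln2]

theorem raceEntropy_le_HX (P : PMF (𝒳 × 𝒴)) : raceEntropy P ≤ HX P := by
  rw [← ENNReal.mul_le_mul_iff_left ln2_ne_zero ln2_ne_top, raceEntropy_mul_ln2, HX_mul_ln2]
  exact ENNReal.tsum_le_tsum fun u => mul_le_mul_right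
    (ENNReal.tsum_le_tsum fun x => raceEntropy_term_le P u x) _

/-- Some map `u` of positive probability merges two inputs of positive mass, which strictly lowers
the entropy of `u(X)` below that of `X`. -/
theorem raceEntropy_lt_HX {P : PMF (𝒳 × 𝒴)} (h : HXgivenY P ≠ 0) : raceEntropy P < HX P := by
  obtain ⟨x, x', y, hne, hx, hx'⟩ := exists_of_HXgivenY_ne_zero h
  obtain ⟨u, hu, hux, hux'⟩ :=
    exists_raceLaw_ne_zero (condLaw P) (condLaw_ne_zero hx) (condLaw_ne_zero hx')
  set π := P.map Prod.fst with hπ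
  have hπx : π x ≠ 0 := fun h0 => hx (by rw [← map_fst_mul_condLaw, ← hπ, h0, zero_mul])
  have hπx' : π x' ≠ 0 := fun h0 => hx' (by rw [← map_fst_mul_condLaw, ← hπ, h0, zero_mul])
  rw [← ENNReal.mul_lt_mul_iff_left ln2_ne_zero ln2_ne_top]
  -- A strict inequality in one term passes to the infinite sum only when the smaller sum is finite.
  have hfin : raceEntropy P * ln2 ≠ ∞ := ENNReal.mul_ne_top
    (ne_top_of_le_ne_top (HX_ne_top P) (raceEntropy_le_HX P)) ln2_ne_top
  have hfin' := hfin
  rw [raceEntropy_mul_ln2] at hfin' ⊢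
  rw [HX_mul_ln2]
  refine ENNReal.tsum_lt_tsum hfin' (fun u => mul_le_mul_right
    (ENNReal.tsum_le_tsum fun x => raceEntropy_term_le P u x) _) (i := u) ?_
  rw [ENNReal.mul_lt_mul_iff_right hu (PMF.apply_ne_top _ _)]
  have hfu := ENNReal.ne_top_of_tsum_ne_top hfin' u
  refine ENNReal.tsum_lt_tsum (fun h => ?_) (fun x => raceEntropy_term_le P u x) (i := x) ?_
  · rw [h, ENNReal.mul_top hu] at hfu
    exact hfu rfl
  have hle : π x + π x' ≤ π.map u (u x) := by
    classical
    rw [PMF.map_apply u π, ← Finset.sum_pair hne (f := fun x => π x)]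
    refine le_trans (Finset.sum_le_sum fun a ha => ?_) (ENNReal.sum_le_tsum {x, x'})
    have : u x = u a := by
      rcases Finset.mem_insert.1 ha with rfl | ha
      · rfl
      · rw [Finset.mem_singleton.1 ha, hux, hux']
    rw [if_pos this]
  have hlt : π x < π.map u (u x) :=
    (ENNReal.lt_add_right (PMF.apply_ne_top _ _) hπx').trans_le hle
  have hpos := ENNReal.toReal_pos hπx (PMF.apply_ne_top _ _)
  have hlt' : (π x).toReal < (π.map u (u x)).toReal :=
    (ENNReal.toReal_lt_toReal (PMF.apply_ne_top _ _) (PMF.apply_ne_top _ _)).2 hlt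
  have h1 : (π.map u (u x)).toReal ≤ 1 :=
    ENNReal.toReal_mono ENNReal.one_ne_top (PMF.coe_le_one _ _)
  rw [ENNReal.mul_lt_mul_iff_right hπx (PMF.apply_ne_top _ _),
    ENNReal.ofReal_lt_ofReal_iff (by linarith [Real.log_neg hpos (hlt'.trans_le h1)])]
  linarith [Real.log_lt_log hpos hlt']

theorem raceEntropy_le (P : PMF (𝒳 × 𝒴)) :
    raceEntropy P ≤ mutualInfo P + ENNReal.ofReal (sfrlConst P) := by
  have hI := mutualInfo_ne_top P
  set I : ℝ := (mutualInfo P).toReal with hIdef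
  have hI0 : 0 ≤ I := ENNReal.toReal_nonneg
  have eI : mutualInfo P = ENNReal.ofReal I := (ENNReal.ofReal_toReal hI).symm
  have hl2 : 0 < Real.log 2 := Real.log_pos one_lt_two
  have hlog : 0 ≤ Real.logb 2 (I + 1) := Real.logb_nonneg one_lt_two (by linarith)
  -- This is the bound of `tsum_condLaw_log_le`, so `(1 + M⁻¹) * M = M + 1` and the estimate becomes
  -- `log M + I * log 2 + 2` nats.
  set M := I * Real.log 2 + 1 with hM
  have hM1 : 1 ≤ M := by have := mul_nonneg hI0 hl2.le; linarith
  have h := raceLaw_entropy_le (condLaw P) (P.map Prod.snd)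
    (fun x y hy => condLaw_eq_zero P x hy) (P.map Prod.fst) hM1
  rw [← raceEntropy_mul_ln2] at h
  have h2 := h.trans (add_le_add_right (mul_le_mul_right (tsum_condLaw_log_le P) _) _)
  rw [eI, ln2, ← ENNReal.ofReal_mul hI0, ← ENNReal.ofReal_one,
    ← ENNReal.ofReal_add (mul_nonneg hI0 hl2.le) zero_le_one, ← hM,
    ← ENNReal.ofReal_mul (by positivity),
    ← ENNReal.ofReal_add (Real.log_nonneg hM1) (by positivity)] at h2
  rw [← ENNReal.mul_le_mul_iff_left ln2_ne_zero ln2_ne_top, eI, sfrlConst, ← hIdef,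
    ← ENNReal.ofReal_add hI0 (by linarith), ln2, ← ENNReal.ofReal_mul (by linarith)]
  refine h2.trans (ENNReal.ofReal_le_ofReal ?_)
  have e1 : (1 + M⁻¹) * M = M + 1 := by field_simp
  have e2 : Real.logb 2 (I + 1) * Real.log 2 = Real.log (I + 1) := by
    rw [Real.logb]; field_simp
  have e3 : Real.log M ≤ Real.log (I + 1) := by
    refine Real.log_le_log (by linarith) ?_
    have : Real.log 2 ≤ 1 := by linarith [Real.log_two_lt_d9]
    have := mul_le_mul_of_nonneg_left this hI0
    linarith
  -- The remaining 2 nats fit into 4 bits, because `4 * log 2 > 2`.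
  have e4 := Real.log_two_gt_d9
  rw [e1]
  nlinarith

end Kernel

end FunctionalRepresentation

/-! ### The upper bound -/

section UpperBound

variable {𝒳 𝒴 V : Type*}

/-- Gibbs' inequality against the law in which `X` and `V` are made independent given `Y`, carried
out termwise so that infinite values are allowed. -/
theorem condEntropy_triangle (J : PMF ((𝒳 × 𝒴) × V)) :
    condEntropy (J.map fun w => (w.2, w.1.1))
      ≤ condEntropy (J.map fun w => (w.2, w.1.2)) + condEntropy (J.map fun w => (w.1.2, w.1.1)) := by
  rw [← ENNReal.mul_le_mul_iff_left ln2_ne_zero ln2_ne_top, add_mul, condEntropy_mul_ln2,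
    condEntropy_mul_ln2, condEntropy_mul_ln2, tsum_map_mul, tsum_map_mul, tsum_map_mul]
  simp only [PMF.map_comp]
  set PU := J.map (Prod.fst ∘ fun w => (w.2, w.1.1)) with hPU
  have hPU' : J.map (Prod.fst ∘ fun w => (w.2, w.1.2)) = PU := rfl
  set PY := J.map (Prod.fst ∘ fun w => (w.1.2, w.1.1)) with hPY
  rw [hPU']
  set A := J.map fun w => (w.2, w.1.1) with hA
  set B := J.map fun w => (w.2, w.1.2) with hB
  set C := J.map fun w => (w.1.2, w.1.1) with hC
  have hBY : B.map Prod.snd = PY := by rw [hB, PMF.map_comp]; rfl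
  have hCY : C.map Prod.fst = PY := by rw [hC, PMF.map_comp]
  have hQ : ∑' w : (𝒳 × 𝒴) × V, B (w.2, w.1.2) * C (w.1.2, w.1.1) / PY w.1.2 ≤ 1 := by
    rw [ENNReal.tsum_prod', ENNReal.tsum_prod', ENNReal.tsum_comm, ← PMF.tsum_coe PY]
    refine ENNReal.tsum_le_tsum fun y => ?_
    simp only [mul_div_assoc, ENNReal.tsum_mul_right]
    simp only [div_eq_mul_inv, ENNReal.tsum_mul_left, ENNReal.tsum_mul_right]
    rw [← map_snd_apply B, hBY, ← map_fst_apply C, hCY]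
    exact mul_le_of_le_one_right zero_le (ENNReal.mul_inv_le_one _)
  have key : ∀ w, J w * ENNReal.ofReal (Real.log ((PU w.2).toReal / (A (w.2, w.1.1)).toReal)) + J w
      ≤ (J w * ENNReal.ofReal (Real.log ((PU w.2).toReal / (B (w.2, w.1.2)).toReal))
        + J w * ENNReal.ofReal (Real.log ((PY w.1.2).toReal / (C (w.1.2, w.1.1)).toReal)))
        + B (w.2, w.1.2) * C (w.1.2, w.1.1) / PY w.1.2 := by
    intro w
    by_cases h0 : J w = 0
    · simp [h0]
    have hJ := ENNReal.toReal_pos h0 (J.apply_ne_top w)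
    have hJA : (J w).toReal ≤ (A (w.2, w.1.1)).toReal :=
      ENNReal.toReal_mono (PMF.apply_ne_top _ _) (apply_le_map J (fun w => (w.2, w.1.1)) w)
    have hJB : (J w).toReal ≤ (B (w.2, w.1.2)).toReal :=
      ENNReal.toReal_mono (PMF.apply_ne_top _ _) (apply_le_map J (fun w => (w.2, w.1.2)) w)
    have hJC : (J w).toReal ≤ (C (w.1.2, w.1.1)).toReal :=
      ENNReal.toReal_mono (PMF.apply_ne_top _ _) (apply_le_map J (fun w => (w.1.2, w.1.1)) w)
    have hJU : (J w).toReal ≤ (PU w.2).toReal :=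
      ENNReal.toReal_mono (PMF.apply_ne_top _ _) (apply_le_map J _ w)
    have hJY : (J w).toReal ≤ (PY w.1.2).toReal :=
      ENNReal.toReal_mono (PMF.apply_ne_top _ _) (apply_le_map J _ w)
    have hAU : (A (w.2, w.1.1)).toReal ≤ (PU w.2).toReal := by
      refine ENNReal.toReal_mono (PMF.apply_ne_top _ _) ?_
      have : A.map Prod.fst = PU := by rw [hA, PMF.map_comp]
      rw [← this]
      exact apply_le_map A Prod.fst (w.2, w.1.1)
    set j := (J w).toReal
    set a := (A (w.2, w.1.1)).toReal
    set b := (B (w.2, w.1.2)).toReal with hb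
    set c := (C (w.1.2, w.1.1)).toReal with hc
    set pu := (PU w.2).toReal
    set py := (PY w.1.2).toReal with hpy
    have ha0 := hJ.trans_le hJA
    have hb0 := hJ.trans_le hJB
    have hc0 := hJ.trans_le hJC
    have hu0 := hJ.trans_le hJU
    have hy0 := hJ.trans_le hJY
    have eJ : J w = ENNReal.ofReal j := (ENNReal.ofReal_toReal (PMF.apply_ne_top _ _)).symm
    have eQ : B (w.2, w.1.2) * C (w.1.2, w.1.1) / PY w.1.2 = ENNReal.ofReal (b * c / py) := by
      rw [ENNReal.ofReal_div_of_pos hy0, ENNReal.ofReal_mul hb0.le, hb, hc, hpy,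
        ENNReal.ofReal_toReal (PMF.apply_ne_top _ _), ENNReal.ofReal_toReal (PMF.apply_ne_top _ _),
        ENNReal.ofReal_toReal (PMF.apply_ne_top _ _)]
    have hl : 0 ≤ Real.log (pu / a) := Real.log_nonneg ((one_le_div ha0).2 hAU)
    rw [eQ, eJ, ← ENNReal.ofReal_mul hJ.le, ← ENNReal.ofReal_mul hJ.le, ← ENNReal.ofReal_mul hJ.le,
      ← ENNReal.ofReal_add (by positivity) hJ.le]
    refine le_trans (ENNReal.ofReal_le_ofReal ?_) (ENNReal.ofReal_add_le.trans
      (add_le_add_left ENNReal.ofReal_add_le _))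
    have h1 := Real.log_le_sub_one_of_pos (x := b * c / (a * py)) (by positivity)
    rw [Real.log_div (by positivity) (by positivity), Real.log_mul hb0.ne' hc0.ne',
      Real.log_mul ha0.ne' hy0.ne'] at h1
    rw [Real.log_div hu0.ne' ha0.ne', Real.log_div hu0.ne' hb0.ne', Real.log_div hy0.ne' hc0.ne']
    have h2 := mul_le_mul_of_nonneg_left h1 hJ.le
    -- Since `j ≤ a`, the factor `j / a` can be dropped; what is left is the mass bounded in `hQ`.
    have h3 : j * (b * c / (a * py)) ≤ b * c / py := by
      have : j * (b * c / (a * py)) = j / a * (b * c / py) := by field_simp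
      rw [this]
      exact mul_le_of_le_one_left (by positivity) ((div_le_one ha0).2 hJA)
    linarith
  have hsum := ENNReal.tsum_le_tsum key
  simp only [ENNReal.tsum_add, PMF.tsum_coe] at hsum
  exact (ENNReal.add_le_add_iff_right ENNReal.one_ne_top).1 (hsum.trans (add_le_add_right hQ _))

theorem mutualInfo_lawYU_le [Finite 𝒳] [Countable 𝒴] (P : PMF (𝒳 × 𝒴)) (κ : 𝒳 × 𝒴 → PMF ℕ) :
    mutualInfo (lawYU P κ) ≤ HYgivenX P + mutualInfo (lawXU P κ) := by
  by_cases hH : HYgivenX P = ∞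
  · simp [hH]
  have hI := mutualInfo_ne_top P
  have hHY : HY P ≠ ∞ := by
    rw [← mutualInfo_add_HYgivenX]
    exact ENNReal.add_ne_top.2 ⟨hI, hH⟩
  have hXU := mutualInfo_add_condEntropy ((lawXU P κ).map Prod.swap)
  have hYU := mutualInfo_add_condEntropy ((lawYU P κ).map Prod.swap)
  rw [mutualInfo_swap, map_snd_swap] at hXU hYU
  rw [show (lawXU P κ).map Prod.fst = P.map Prod.fst from kernelLawMap_fst Prod.fst P κ] at hXU
  rw [show (lawYU P κ).map Prod.fst = P.map Prod.snd from kernelLawMap_fst Prod.snd P κ] at hYU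
  change _ = HX P at hXU
  change _ = HY P at hYU
  have htri := condEntropy_triangle (jointLaw P κ)
  rw [show (jointLaw P κ).map (fun w => (w.2, w.1.1)) = (lawXU P κ).map Prod.swap by
      rw [lawXU, PMF.map_comp]; rfl,
    show (jointLaw P κ).map (fun w => (w.2, w.1.2)) = (lawYU P κ).map Prod.swap by
      rw [lawYU, PMF.map_comp]; rfl,
    show (jointLaw P κ).map (fun w => (w.1.2, w.1.1)) = P.map Prod.swap by
      have h1 : (jointLaw P κ).map Prod.fst = P := by
        have := kernelLawMap_fst id P κ
        rwa [PMF.map_id, kernelLawMap, PMF.map_comp] at this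
      conv_rhs => rw [← h1, PMF.map_comp]
      rfl] at htri
  change _ ≤ _ + HXgivenY P at htri
  set hx := condEntropy ((lawXU P κ).map Prod.swap)
  set hy := condEntropy ((lawYU P κ).map Prod.swap)
  have hxt : hx ≠ ∞ := ne_top_of_le_ne_top (HX_ne_top P) (hXU ▸ le_add_self)
  have hyt : hy ≠ ∞ := ne_top_of_le_ne_top hHY (hYU ▸ le_add_self)
  have e1 := mutualInfo_add_HYgivenX P
  have e2 := mutualInfo_add_HXgivenY P
  -- Adding the finite `H(X|U)` and `H(Y|U)` to both sides avoids truncated subtraction.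
  refine (ENNReal.add_le_add_iff_right (ENNReal.add_ne_top.2 ⟨hxt, hyt⟩)).1 ?_
  calc mutualInfo (lawYU P κ) + (hx + hy) = HY P + hx := by rw [← hYU]; ring
    _ ≤ HY P + (hy + HXgivenY P) := add_le_add_right htri _
    _ = HYgivenX P + HX P + hy := by rw [← e1, ← e2]; ring
    _ = HYgivenX P + mutualInfo (lawXU P κ) + (hx + hy) := by rw [← hXU]; ring

theorem hFun_le [Finite 𝒳] [Countable 𝒴] (P : PMF (𝒳 × 𝒴)) (ε : ℝ) :
    hFun ε P ≤ HYgivenX P + ENNReal.ofReal ε :=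
  iSup₂_le fun κ hκ => (mutualInfo_lawYU_le P κ).trans (add_le_add_right hκ _)

end UpperBound

/-! ### The lower bounds and their tightness -/

section LowerBound

variable {𝒳 𝒴 V : Type*}

theorem sfrlConst_nonneg (P : PMF (𝒳 × 𝒴)) : 0 ≤ sfrlConst P := by
  have := Real.logb_nonneg one_lt_two
    (show 1 ≤ (mutualInfo P).toReal + 1 by linarith [ENNReal.toReal_nonneg (a := mutualInfo P)])
  rw [sfrlConst]
  linarith

theorem coe_ofReal_of_nonneg {x : ℝ} (hx : 0 ≤ x) : ((ENNReal.ofReal x : ℝ≥0∞) : EReal) = x := by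
  rw [EReal.coe_ennreal_ofReal, max_eq_left hx]

theorem coe_toReal_of_ne_top {x : ℝ≥0∞} (hx : x ≠ ∞) : ((x.toReal : ℝ) : EReal) = x := by
  rw [← coe_ofReal_of_nonneg ENNReal.toReal_nonneg, ENNReal.ofReal_toReal hx]

theorem min_le_convex {a b s : ℝ} (h0 : 0 ≤ s) (h1 : s ≤ 1) : min a b ≤ (1 - s) * a + s * b := by
  have h2 := mul_le_mul_of_nonneg_left (min_le_left a b) (sub_nonneg.2 h1)
  have h3 := mul_le_mul_of_nonneg_left (min_le_right a b) h0
  linarith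

theorem sub_add_sub_coe (x : EReal) (a b c : ℝ) :
    x - (a : EReal) + (b : EReal) - (c : EReal) = x + (b : EReal) - ((c + a : ℝ) : EReal) := by
  simp only [sub_eq_add_neg, add_assoc, ← EReal.coe_neg, ← EReal.coe_add]
  congr 2
  ring

variable [Finite 𝒳] [Countable 𝒴]

/-- Disclosing `Y` a fraction `ε / I(X; Y)` of the time, and otherwise using a perfectly private
kernel. -/
theorem timeShare_le_hFun [Countable V] (P : PMF (𝒳 × 𝒴)) {ε : ℝ}
    (hεI : ENNReal.ofReal ε < mutualInfo P) (κ₀ : 𝒳 × 𝒴 → PMF V)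
    (hκ₀ : mutualInfo (kernelLawMap Prod.fst P κ₀) = 0) :
    (1 - ENNReal.ofReal ε / mutualInfo P) * mutualInfo (kernelLawMap Prod.snd P κ₀)
      + ENNReal.ofReal ε / mutualInfo P * HY P ≤ hFun ε P := by
  have hI := mutualInfo_ne_top P
  have hI0 : mutualInfo P ≠ 0 := (zero_le.trans_lt hεI).ne'
  have ht : ENNReal.ofReal ε / mutualInfo P ≤ 1 := ENNReal.div_le_of_le_mul (by simpa using hεI.le)
  obtain ⟨κ, hX, hY⟩ := exists_timeShare P _ ht κ₀ fun z => PMF.pure z.2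
  rw [hκ₀, (mutualInfo_kernelLawMap_pure_snd P).1, mul_zero, zero_add,
    ENNReal.div_mul_cancel hI0 hI] at hX
  rw [(mutualInfo_kernelLawMap_pure_snd P).2] at hY
  rw [← hY]
  exact le_iSup₂ (f := fun (κ : 𝒳 × 𝒴 → PMF ℕ)
    (_ : mutualInfo (lawXU P κ) ≤ ENNReal.ofReal ε) => mutualInfo (lawYU P κ)) κ hX.le

/-- The race achieves at least `H(Y|X) - d` and disclosing `Y` achieves `H(Y|X) + I(X;Y)`. Mixing
with weight `ε / I(X;Y)` on the latter gains exactly `ε`. -/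
theorem HYgivenX_add_le_hFun_add (P : PMF (𝒳 × 𝒴)) {ε : ℝ}
    (hεI : ENNReal.ofReal ε < mutualInfo P) {d : ℝ≥0∞} (hd : raceEntropy P ≤ mutualInfo P + d) :
    HYgivenX P + ENNReal.ofReal ε ≤ hFun ε P + d := by
  have hI := mutualInfo_ne_top P
  have hI0 : mutualInfo P ≠ 0 := (zero_le.trans_lt hεI).ne'
  have ht : ENNReal.ofReal ε / mutualInfo P ≤ 1 := ENNReal.div_le_of_le_mul (by simpa using hεI.le)
  have h := timeShare_le_hFun P hεI (raceKernel P) (raceKernel_independent P)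
  have hr := mutualInfo_add_raceEntropy P
  have he : ENNReal.ofReal ε / mutualInfo P * mutualInfo P = ENNReal.ofReal ε :=
    ENNReal.div_mul_cancel hI0 hI
  set t := ENNReal.ofReal ε / mutualInfo P
  set I₀ := mutualInfo (kernelLawMap Prod.snd P (raceKernel P))
  have hH : HYgivenX P ≤ I₀ + d := by
    refine (ENNReal.add_le_add_iff_left hI).1 ?_
    calc mutualInfo P + HYgivenX P = I₀ + raceEntropy P := by rw [mutualInfo_add_HYgivenX, hr]
      _ ≤ I₀ + (mutualInfo P + d) := add_le_add_right hd _
      _ = mutualInfo P + (I₀ + d) := by ring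
  calc HYgivenX P + ENNReal.ofReal ε
      = (1 - t + t) * HYgivenX P + t * mutualInfo P := by
        rw [tsub_add_cancel_of_le ht, one_mul, he]
    _ = (1 - t) * HYgivenX P + t * HY P := by rw [← mutualInfo_add_HYgivenX]; ring
    _ ≤ (1 - t) * (I₀ + d) + t * HY P := by gcongr
    _ = (1 - t) * I₀ + t * HY P + (1 - t) * d := by ring
    _ ≤ hFun ε P + d := add_le_add h (mul_le_of_le_one_left zero_le tsub_le_self)

theorem timeShare_gZero_le_hFun (P : PMF (𝒳 × 𝒴)) {ε : ℝ}
    (hεI : ENNReal.ofReal ε < mutualInfo P) :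
    ENNReal.ofReal ε / mutualInfo P * HY P + gZero P * (1 - ENNReal.ofReal ε / mutualInfo P)
      ≤ hFun ε P := by
  set t := ENNReal.ofReal ε / mutualInfo P with ht
  have h0 : t * HY P ≤ hFun ε P :=
    le_add_self.trans (timeShare_le_hFun P hεI (raceKernel P) (raceKernel_independent P))
  -- The supremum is bounded by subtracting `t * HY P`, which must be finite for the subtraction to
  -- be reversible.
  by_cases htop : t * HY P = ∞
  · rw [htop, top_le_iff] at h0
    rw [h0]
    exact le_top
  refine (ENNReal.le_sub_iff_add_le_left htop h0).1 ?_
  rw [gZero, ENNReal.iSup_mul]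
  refine iSup_le fun κ => ?_
  rw [ENNReal.iSup_mul]
  refine iSup_le fun hκ => (ENNReal.le_sub_iff_add_le_left htop h0).2 ?_
  have := timeShare_le_hFun P hεI κ hκ.1
  rw [add_comm, mul_comm]
  exact this

/-- Common source of `L1`, `L2`, `L4` and `L5`: the smaller of the two race penalties is already
achieved, and each of these bounds subtracts at least as much. -/
theorem HYgivenX_sub_le_hFun (P : PMF (𝒳 × 𝒴)) {ε : ℝ} (hε : 0 ≤ ε)
    (hεI : ENNReal.ofReal ε < mutualInfo P) {d : ℝ}
    (hd : min (sfrlConst P) (HXgivenY P).toReal ≤ d) :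
    (HYgivenX P : EReal) + (ε : EReal) - (d : EReal) ≤ (hFun ε P : EReal) := by
  have hd0 : 0 ≤ d := (le_min (sfrlConst_nonneg P) ENNReal.toReal_nonneg).trans hd
  have h : HYgivenX P + ENNReal.ofReal ε ≤ hFun ε P + ENNReal.ofReal d := by
    refine HYgivenX_add_le_hFun_add P hεI ?_
    rcases min_le_iff.1 hd with h | h
    · exact (raceEntropy_le P).trans (add_le_add_right (ENNReal.ofReal_le_ofReal h) _)
    · refine (raceEntropy_le_HX P).trans ?_
      rw [← mutualInfo_add_HXgivenY]
      refine add_le_add_right ?_ _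
      rw [← ENNReal.ofReal_toReal (HXgivenY_ne_top P)]
      exact ENNReal.ofReal_le_ofReal h
  refine EReal.sub_le_of_le_add ?_
  have := EReal.coe_ennreal_le_coe_ennreal_iff.2 h
  rwa [EReal.coe_ennreal_add, EReal.coe_ennreal_add, coe_ofReal_of_nonneg hε,
    coe_ofReal_of_nonneg hd0] at this

theorem L1_eq (P : PMF (𝒳 × 𝒴)) (ε : ℝ) :
    L1 ε P = (HYgivenX P : EReal) + (ε : EReal) - ((HXgivenY P).toReal : EReal) := by
  rw [L1, ← coe_toReal_of_ne_top (HXgivenY_ne_top P), sub_eq_add_neg, sub_eq_add_neg, add_right_comm]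

theorem L1_le_hFun (P : PMF (𝒳 × 𝒴)) {ε : ℝ} (hε : 0 ≤ ε)
    (hεI : ENNReal.ofReal ε < mutualInfo P) : L1 ε P ≤ (hFun ε P : EReal) := by
  rw [L1_eq]
  exact HYgivenX_sub_le_hFun P hε hεI (min_le_right _ _)

theorem L2_le_hFun (P : PMF (𝒳 × 𝒴)) {ε : ℝ} (hε : 0 ≤ ε)
    (hεI : ENNReal.ofReal ε < mutualInfo P) : L2 ε P ≤ (hFun ε P : EReal) := by
  have hεX : ENNReal.ofReal ε ≤ HX P := hεI.le.trans (mutualInfo_add_HXgivenY P ▸ le_self_add)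
  have hα0 : 0 ≤ alpha ε P := div_nonneg hε ENNReal.toReal_nonneg
  have hα1 : alpha ε P ≤ 1 :=
    div_le_one_of_le₀ ((ENNReal.ofReal_le_iff_le_toReal (HX_ne_top P)).1 hεX) ENNReal.toReal_nonneg
  have h := HYgivenX_sub_le_hFun P hε hεI (min_le_convex hα0 hα1)
  refine le_of_eq_of_le ?_ h
  exact sub_add_sub_coe _ _ _ _

theorem L3_le_hFun (P : PMF (𝒳 × 𝒴)) {ε : ℝ} (hε : 0 ≤ ε)
    (hεI : ENNReal.ofReal ε < mutualInfo P) : L3 ε P ≤ (hFun ε P : EReal) := by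
  have hI := mutualInfo_ne_top P
  have hI0 : 0 < (mutualInfo P).toReal := ENNReal.toReal_pos (zero_le.trans_lt hεI).ne' hI
  have ht : ENNReal.ofReal ε / mutualInfo P = ENNReal.ofReal (ε / (mutualInfo P).toReal) := by
    rw [ENNReal.ofReal_div_of_pos hI0, ENNReal.ofReal_toReal hI]
  have h0 : 0 ≤ ε / (mutualInfo P).toReal := div_nonneg hε hI0.le
  have h1 : ε / (mutualInfo P).toReal ≤ 1 :=
    div_le_one_of_le₀ ((ENNReal.ofReal_le_iff_le_toReal hI).1 hεI.le) hI0.le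
  have h := timeShare_gZero_le_hFun P hεI
  rw [ht, ← ENNReal.ofReal_one, ← ENNReal.ofReal_sub _ h0] at h
  have := EReal.coe_ennreal_le_coe_ennreal_iff.2 h
  rwa [EReal.coe_ennreal_add, EReal.coe_ennreal_mul, EReal.coe_ennreal_mul,
    coe_ofReal_of_nonneg h0, coe_ofReal_of_nonneg (sub_nonneg.2 h1)] at this

theorem L4_le_hFun (P : PMF (𝒳 × 𝒴)) {ε : ℝ} (hε : 0 ≤ ε)
    (hεI : ENNReal.ofReal ε < mutualInfo P) : L4 ε P ≤ (hFun ε P : EReal) := by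
  have h := HYgivenX_sub_le_hFun P hε hεI (min_le_left _ _)
  refine le_trans ?_ h
  have h0 : (0 : EReal) ≤ ⨅ (r : Representation 𝒳) (_ : 0 < HX2 P r),
      ((alpha2 ε P r * (HX2givenY P r).toReal : ℝ) : EReal) :=
    le_iInf₂ fun r _ => EReal.coe_nonneg.2
      (mul_nonneg (div_nonneg hε ENNReal.toReal_nonneg) ENNReal.toReal_nonneg)
  rw [L4]
  exact (EReal.sub_le_sub le_rfl h0).trans_eq (sub_zero _)

theorem L5_le_hFun (P : PMF (𝒳 × 𝒴)) {ε : ℝ} (hε : 0 ≤ ε)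
    (hεI : ENNReal.ofReal ε < mutualInfo P) : L5 ε P ≤ (hFun ε P : EReal) := by
  refine le_trans ?_ (HYgivenX_sub_le_hFun P hε hεI le_rfl)
  rw [L5]
  refine EReal.sub_le_sub le_rfl (le_iInf₂ fun r hr => EReal.coe_le_coe_iff.2 ?_)
  have ht : HX2 P r ≠ ∞ := entropy_ne_top _
  exact min_le_convex (div_nonneg hε ENNReal.toReal_nonneg)
    (div_le_one_of_le₀ ((ENNReal.ofReal_le_iff_le_toReal ht).1 hr.2) ENNReal.toReal_nonneg)

theorem L1_eq_HY_sub_HX (P : PMF (𝒳 × 𝒴)) (ε : ℝ) :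
    L1 ε P = (HY P : EReal) - (HX P : EReal) + (ε : EReal) := by
  rw [L1, ← mutualInfo_add_HYgivenX, ← mutualInfo_add_HXgivenY, EReal.coe_ennreal_add,
    EReal.coe_ennreal_add, ← coe_toReal_of_ne_top (HXgivenY_ne_top P),
    ← coe_toReal_of_ne_top (mutualInfo_ne_top P)]
  congr 1
  by_cases h : HYgivenX P = ∞
  · rw [h, EReal.coe_ennreal_top, EReal.coe_add_top, ← EReal.coe_add, EReal.top_sub_coe,
      EReal.top_sub_coe]
  · rw [← coe_toReal_of_ne_top h]
    norm_cast
    ring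

/-- If `H(X|Y) ≠ 0`, the race penalty `H(Y|U) - I(X;Y)` is strictly below `H(X|Y)`, so `hFun`
exceeds `L1`. Finiteness of `H(Y)` makes `hFun` finite, without which the strict gap would be lost.
-/
theorem HXgivenY_eq_zero_of_L1_eq (P : PMF (𝒳 × 𝒴)) {ε : ℝ} (hε : 0 ≤ ε)
    (hεI : ENNReal.ofReal ε < mutualInfo P) (hY : HY P ≠ ∞) (h : L1 ε P = (hFun ε P : EReal)) :
    HXgivenY P = 0 := by
  by_contra hne
  have hK := HXgivenY_ne_top P
  have hH : HYgivenX P ≠ ∞ := ne_top_of_le_ne_top hY (mutualInfo_add_HYgivenX P ▸ le_add_self)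
  have hh : hFun ε P ≠ ∞ :=
    ne_top_of_le_ne_top (ENNReal.add_ne_top.2 ⟨hH, ENNReal.ofReal_ne_top⟩) (hFun_le P ε)
  have hle := HYgivenX_add_le_hFun_add P hεI (d := raceEntropy P - mutualInfo P) le_add_tsub
  have hlt : raceEntropy P - mutualInfo P < HXgivenY P := by
    rcases le_total (raceEntropy P) (mutualInfo P) with hr | hr
    · rw [tsub_eq_zero_of_le hr]
      exact pos_iff_ne_zero.2 hne
    · refine ENNReal.sub_lt_of_lt_add hr ?_
      rw [add_comm, mutualInfo_add_HXgivenY]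
      exact raceEntropy_lt_HX hne
  have heq : HYgivenX P + ENNReal.ofReal ε = hFun ε P + HXgivenY P := by
    rw [L1_eq, ← coe_toReal_of_ne_top hH, ← coe_toReal_of_ne_top hh, ← EReal.coe_add,
      ← EReal.coe_sub, EReal.coe_eq_coe_iff] at h
    rw [← ENNReal.ofReal_toReal hH, ← ENNReal.ofReal_toReal hh, ← ENNReal.ofReal_toReal hK,
      ← ENNReal.ofReal_add ENNReal.toReal_nonneg hε,
      ← ENNReal.ofReal_add ENNReal.toReal_nonneg ENNReal.toReal_nonneg]
    congr 1
    linarith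
  rw [heq, ENNReal.add_le_add_iff_left hh] at hle
  exact absurd hle (not_le.2 hlt)

end LowerBound

end PrivacyFunnel

theorem theorem1 {𝒳 𝒴 : Type*} [Finite 𝒳] [Countable 𝒴] (P : PMF (𝒳 × 𝒴)) (ε : ℝ)
    (hε : 0 ≤ ε) (hεI : ENNReal.ofReal ε < PrivacyFunnel.mutualInfo P) :
    -- the lower bounds and the upper bound
    (max (max (max (max (PrivacyFunnel.L1 ε P) (PrivacyFunnel.L2 ε P)) (PrivacyFunnel.L3 ε P))
          (PrivacyFunnel.L4 ε P)) (PrivacyFunnel.L5 ε P)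
        ≤ (PrivacyFunnel.hFun ε P : EReal) ∧
      (PrivacyFunnel.hFun ε P : EReal) ≤ PrivacyFunnel.U1 ε P) ∧
    -- the second expression for the first lower bound
    PrivacyFunnel.L1 ε P
      = (PrivacyFunnel.HY P : EReal) - (PrivacyFunnel.HX P : EReal) + (ε : EReal) ∧
    -- `H(X | Y) = 0` means that `X` is a deterministic function of `Y`
    (PrivacyFunnel.HXgivenY P = 0 ↔ ∃ f : 𝒴 → 𝒳, ∀ z ∈ P.support, z.1 = f z.2) ∧
    -- tightness of the lower bound
    (PrivacyFunnel.HXgivenY P = 0 →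
      max (max (max (max (PrivacyFunnel.L1 ε P) (PrivacyFunnel.L2 ε P)) (PrivacyFunnel.L3 ε P))
          (PrivacyFunnel.L4 ε P)) (PrivacyFunnel.L5 ε P)
        = (PrivacyFunnel.hFun ε P : EReal)) ∧
    -- tightness of the first lower bound
    (PrivacyFunnel.HY P ≠ ∞ → PrivacyFunnel.L1 ε P = (PrivacyFunnel.hFun ε P : EReal) →
      PrivacyFunnel.HXgivenY P = 0) := by
  have hU := PrivacyFunnel.hFun_le P ε
  have hU1 : (PrivacyFunnel.hFun ε P : EReal) ≤ PrivacyFunnel.U1 ε P := by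
    have := EReal.coe_ennreal_le_coe_ennreal_iff.2 hU
    rwa [EReal.coe_ennreal_add, PrivacyFunnel.coe_ofReal_of_nonneg hε] at this
  have hmax : max (max (max (max (PrivacyFunnel.L1 ε P) (PrivacyFunnel.L2 ε P))
      (PrivacyFunnel.L3 ε P)) (PrivacyFunnel.L4 ε P)) (PrivacyFunnel.L5 ε P)
      ≤ (PrivacyFunnel.hFun ε P : EReal) :=
    max_le (max_le (max_le (max_le (PrivacyFunnel.L1_le_hFun P hε hεI)
      (PrivacyFunnel.L2_le_hFun P hε hεI)) (PrivacyFunnel.L3_le_hFun P hε hεI))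
      (PrivacyFunnel.L4_le_hFun P hε hεI)) (PrivacyFunnel.L5_le_hFun P hε hεI)
  refine ⟨⟨hmax, hU1⟩, PrivacyFunnel.L1_eq_HY_sub_HX P ε,
    PrivacyFunnel.HXgivenY_eq_zero_iff_exists P, fun h0 => le_antisymm hmax ?_,
    fun hY h => PrivacyFunnel.HXgivenY_eq_zero_of_L1_eq P hε hεI hY h⟩
  -- When `H(X|Y) = 0`, the first lower bound alone already meets the upper bound.
  have hL1 : PrivacyFunnel.U1 ε P = PrivacyFunnel.L1 ε P := by
    rw [PrivacyFunnel.L1_eq, h0, PrivacyFunnel.U1, ENNReal.toReal_zero, EReal.coe_zero, sub_zero]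
  refine (hU1.trans_eq hL1).trans ?_
  exact le_max_of_le_left (le_max_of_le_left (le_max_of_le_left (le_max_left _ _)))
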